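/- Let $A$ be a Borel space, i.e. a measurable space that is isomorphic, as a measurable space, to a Borel subset of $[0,1]$. For a word $\mathbf w=(w_1,\dots,w_n)\in A^n$ and $i\in[n]=\{1,\dots,n\}$ let $\mathrm{erase}(\mathbf w,i)=(w_1,\dots,w_{i-1},w_{i+1},\dots,w_n)$. A general erased-word process (GEWP) over $A$ is a stochastic process $(\mathbf W,\boldsymbol\eta)=(\mathbf W_n,\eta_n)_{n\ge1}$ such that for each $n$: (i) $\mathbf W_n$ is a random word of length $n$ over $A$; (ii) $\eta_n$ is uniformly distributed on $[n]$ and independent of the $\sigma$-field $\sigma(\mathbf W_k,\eta_{k+1}:k\ge n)$; (iii) $\mathbf W_n=\mathrm{erase}(\mathbf W_{n+1},\eta_{n+1})$ almost surely. Let $\mathcal M(A)$ be the set of the laws on $\prod_{n\ge1}A^n\times[n]$ of all GEWPs over $A$, and let $\mathrm{erg}\,\mathcal M(A)$ be the set of its extreme points; a GEWP is called ergodic if its law belongs to $\mathrm{erg}\,\mathcal M(A)$. Let $\mathcal C(A)$ be the set of the probability measures on $A\times\mathbb R$ whose second marginal is the uniform distribution on $[0,1]$. For $y_1,\dots,y_n\in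 A$ and $x_1,\dots,x_n\in\mathbb R$ let $\mathrm{ios}(y_1,\dots,y_n,x_1,\dots,x_n)=(y_{\pi(1)},\dots,y_{\pi(n)})$, where $\pi$ is the permutation of $[n]$ with $x_{\pi(1)}\le\dots\le x_{\pi(n)}$ that keeps the indices of equal values in increasing order. **Theorem 1.** Let $\rho\in\mathcal C(A)$ and let $(Y_j,U_j)_{j\ge1}$ be i.i.d. with law $\rho$. For each $n\ge1$ define $$\mathbf W_n:=\mathrm{ios}(Y_1,\dots,Y_n,U_1,\dots,U_n),\qquad \eta_n:=\#\{k\in[n]:U_k\le U_n\}.$$ Then $(\mathbf W,\boldsymbol\eta)=(\mathbf W_n,\eta_n)_{n\ge1}$ is an ergodic GEWP. Its law depends only on $\rho$; writing $\mathrm{GL}(\rho)$ for this law, the map $\mathcal C(A)\to\mathrm{erg}\,\mathcal M(A)$, $\rho\mapsto\mathrm{GL}(\rho)$, is a bijection. -/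

import Mathlib

open MeasureTheory ProbabilityTheory
open scoped NNReal ENNReal

universe u v

namespace ErasedWord

section Defs

/- Indexing convention: words have positive length, so the word of length `n + 1` and the eraser
acting on it carry the index `n : ℕ`, and positions in this word are numbered `0, …, n`. -/

/-- `erase w i` is the word obtained from `w` by erasing its `i`-th letter. -/
def erase {A : Type u} {n : ℕ} (w : Fin (n + 1) → A) (i : Fin (n + 1)) : Fin n → A :=
  fun j => w (i.succAbove j)

/-- The space of all sequences (word of length `n + 1`, position in this word), `n = 0, 1, 2, …`,
with its product σ-algebra. -/
abbrev PathSpace (A : Type u) : Type u := ∀ n : ℕ, (Fin (n + 1) → A) × Fin (n + 1)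

section Setup

variable {A : Type u} [MeasurableSpace A] {Ω : Type v} [MeasurableSpace Ω]

/-- The σ-algebra generated by the words with index `≥ n` and the erasers with index `≥ n + 1`. -/
abbrev tailSigma (W : ∀ n : ℕ, Ω → (Fin (n + 1) → A)) (η : ∀ n : ℕ, Ω → Fin (n + 1)) (n : ℕ) :
    MeasurableSpace Ω :=
  ⨆ k : ℕ, ⨆ _ : n ≤ k,
    MeasurableSpace.comap (W k) inferInstance ⊔ MeasurableSpace.comap (η (k + 1)) inferInstance

/-- `(W, η)` is a general erased-word process over `A` on the measure space `(Ω, μ)`. -/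
structure IsGEWP (μ : Measure Ω) (W : ∀ n : ℕ, Ω → (Fin (n + 1) → A))
    (η : ∀ n : ℕ, Ω → Fin (n + 1)) : Prop where
  isProbabilityMeasure : IsProbabilityMeasure μ
  measurable_word : ∀ n, Measurable (W n)
  measurable_eraser : ∀ n, Measurable (η n)
  uniform : ∀ n (i : Fin (n + 1)), μ (η n ⁻¹' {i}) = ((n : ℝ≥0∞) + 1)⁻¹
  indep : ∀ n, Indep (MeasurableSpace.comap (η n) inferInstance) (tailSigma W η n) μ
  erase_ae : ∀ n, ∀ᵐ ω ∂μ, W n ω = erase (W (n + 1) ω) (η (n + 1) ω)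

/-- The law of the process `(W, η)` on the path space. -/
noncomputable def law (μ : Measure Ω) (W : ∀ n : ℕ, Ω → (Fin (n + 1) → A))
    (η : ∀ n : ℕ, Ω → Fin (n + 1)) : Measure (PathSpace A) :=
  μ.map (fun ω n => (W n ω, η n ω))

end Setup

/-- The set of all laws of general erased-word processes over `A`. -/
def gewpLaws (A : Type u) [MeasurableSpace A] : Set (Measure (PathSpace A)) :=
  {P | ∃ (Ω : Type u) (_ : MeasurableSpace Ω) (μ : Measure Ω)
    (W : ∀ n : ℕ, Ω → (Fin (n + 1) → A)) (η : ∀ n : ℕ, Ω → Fin (n + 1)),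
    IsGEWP μ W η ∧ P = law μ W η}

/-- The ergodic laws: the extreme points of the set of all laws of general erased-word processes.
(Scalars in `ℝ≥0`, since measures can only be multiplied by nonnegative scalars.) -/
def ergodicLaws (A : Type u) [MeasurableSpace A] : Set (Measure (PathSpace A)) :=
  (gewpLaws A).extremePoints ℝ≥0

/-- An ergodic general erased-word process: one whose law is ergodic. -/
def IsErgodicGEWP {A : Type u} [MeasurableSpace A] {Ω : Type v} [MeasurableSpace Ω]
    (μ : Measure Ω) (W : ∀ n : ℕ, Ω → (Fin (n + 1) → A)) (η : ∀ n : ℕ, Ω → Fin (n + 1)) : Prop :=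
  IsGEWP μ W η ∧ law μ W η ∈ ergodicLaws A

/-- The probability measures on `A × ℝ` whose second marginal is uniform on `[0, 1]`. -/
def uniformSecondMarginal (A : Type u) [MeasurableSpace A] : Set (Measure (A × ℝ)) :=
  {ρ | IsProbabilityMeasure ρ ∧ ρ.map Prod.snd = volume.restrict (Set.Icc (0 : ℝ) 1)}

/-- Induced order statistics of `y` with respect to `x`: the letters `y` rearranged by the
permutation that sorts `x` non-decreasingly and stably. -/
noncomputable def inducedOrderStatistics {A : Type u} {n : ℕ} (y : Fin n → A) (x : Fin n → ℝ) : Fin n → A :=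
  fun i => y (Tuple.sort x i)

/-- The position (counted from `0`, whence the `- 1`) of `x n` among `x 0, …, x n`, i.e.
`#{k ≤ n : x k ≤ x n} - 1`. The count is at least `1`, because `k = n` is counted. -/
noncomputable def lastRank (n : ℕ) (x : ℕ → ℝ) : Fin (n + 1) :=
  ⟨((Finset.range (n + 1)).filter (fun k => x k ≤ x n)).card - 1, by
    have h := Finset.card_filter_le (Finset.range (n + 1)) (fun k => x k ≤ x n)
    rw [Finset.card_range] at h
    omega⟩

/-- The word of length `n + 1` built from sequences `y` of letters and `x` of reals. -/
noncomputable def word {A : Type u} (n : ℕ) (y : ℕ → A) (x : ℕ → ℝ) : Fin (n + 1) → A :=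
  inducedOrderStatistics (fun i : Fin (n + 1) => y i) (fun i : Fin (n + 1) => x i)

/-- `lawGL ρ` is the law of the process of induced order statistics and ranks built from an iid
sequence with law `ρ`, here realized as the coordinate sequence under the product measure. -/
noncomputable def lawGL {A : Type u} [MeasurableSpace A] (ρ : Measure (A × ℝ)) :
    Measure (PathSpace A) :=
  law (Measure.infinitePi (fun _ : ℕ => ρ))
    (fun n ω => word n (fun j => (ω j).1) (fun j => (ω j).2))
    (fun n ω => lastRank n (fun j => (ω j).2))

end Defs

end ErasedWord

open scoped Nat

/-! Read forward in time, each step inserts a letter, and a letter already present only moves when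
later letters are inserted to its left. Its relative position has a limit in [0,1], its mark.
`ofPath` sends a path to the sequence of (inserted letter, mark); `toPath` goes back by sorting
letters by marks and recording ranks. On laws these maps are mutually inverse between the GEWP laws
and the exchangeable laws on sequences in `A × ℝ` whose marks are i.i.d. uniform, and `lawGL ρ`
corresponds to the product measure of `ρ`. What remains is that the extreme points of this set of
exchangeable laws are its product measures.

The correspondence rests on `Exchangeable.isGEWP`, `IsGEWP.exchangeable`, `IsGEWP.map_marks` and
`IsGEWP.toPath_ofPath`. For exchangeability, the arrangement of the first `n + 1` letters is a
uniform permutation independent of `tailSigma W η n`, and once it is fixed the marked sequence is a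
function of that tail. The marks depend on the erasers alone, which have the same law in every GEWP,
so almost sure statements about them may be checked in the model where the erasers are ranks of
i.i.d. uniform variables. There the strong law of large numbers shows that the marks are these
variables.

A product measure is ergodic for the shift, hence equals every invariant probability measure
absolutely continuous to it, and so is extreme. Conversely, the law of the shifted sequence given
that the first term lies in `B`, and the one given that it lies in `Bᶜ`, are exchangeable and
average to the original law. Extremality forces both to equal it, so the first term is independent
of the rest, and iteration gives a product measure. De Finetti's integral representation is not
needed. -/

namespace ErasedWord

/-! ### Deterministic combinatorics of positions, ranks and sorting. -/

section Positions

/-- The new position of the letter at position `p` after inserting a letter at position `q`. -/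
def bump (q p : ℕ) : ℕ := if p < q then p else p + 1

lemma val_succAbove {n : ℕ} (q : Fin (n + 2)) (p : Fin (n + 1)) :
    ((q.succAbove p : Fin (n + 2)) : ℕ) = bump q p := by
  unfold bump Fin.succAbove
  simp only [Fin.lt_def, Fin.val_castSucc]
  split_ifs <;> simp

/-- The position in the word with index `n + m` of the letter which has position `p` in the word
with index `n`. -/
def push (η : ∀ k : ℕ, Fin (k + 1)) : ℕ → ℕ → ℕ → ℕ
  | _, 0, p => p
  | n, m + 1, p => push η (n + 1) m (bump (η (n + 1)) p)

/-- The asymptotic relative position of the letter which has position `p` in the word with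
index `n`. -/
noncomputable def limitPosition (η : ∀ k : ℕ, Fin (k + 1)) (n p : ℕ) : ℝ :=
  Filter.limsup (fun m : ℕ => (push η n m p : ℝ) / ((n + m + 1 : ℕ) : ℝ)) Filter.atTop

/-- Dropping the first term of a sequence keeps its limsup. Using limsup instead of a limit makes
this valid for every eraser sequence, without any convergence. -/
lemma limitPosition_succ (η : ∀ k : ℕ, Fin (k + 1)) (n p : ℕ) :
    limitPosition η (n + 1) (bump (η (n + 1)) p) = limitPosition η n p := by
  unfold limitPosition
  rw [← Filter.limsup_nat_add (fun m : ℕ => (push η n m p : ℝ) / ((n + m + 1 : ℕ) : ℝ)) 1]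
  congr 1
  funext m
  rw [show n + (m + 1) + 1 = n + 1 + m + 1 by ring]
  rfl

/-- The position in the word with index `n` of the letter inserted at step `j ≤ n`. -/
def place (η : ∀ k : ℕ, Fin (k + 1)) : ∀ n : ℕ, Fin (n + 1) → Fin (n + 1)
  | 0 => id
  | n + 1 => Fin.lastCases (motive := fun _ => Fin (n + 2)) (η (n + 1))
      (fun j => (η (n + 1)).succAbove (place η n j))

@[simp] lemma place_succ_last (η : ∀ k : ℕ, Fin (k + 1)) (n : ℕ) :
    place η (n + 1) (Fin.last (n + 1)) = η (n + 1) := by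
  simp [place]

@[simp] lemma place_succ_castSucc (η : ∀ k : ℕ, Fin (k + 1)) (n : ℕ) (j : Fin (n + 1)) :
    place η (n + 1) j.castSucc = (η (n + 1)).succAbove (place η n j) := by
  simp [place]

lemma place_injective (η : ∀ k : ℕ, Fin (k + 1)) (n : ℕ) : Function.Injective (place η n) := by
  induction n with
  | zero => exact Function.injective_id
  | succ n ih =>
    intro i j hij
    induction i using Fin.lastCases with
    | last =>
      induction j using Fin.lastCases with
      | last => rfl
      | cast j =>
        simp only [place_succ_last, place_succ_castSucc] at hij
        exact absurd hij.symm (Fin.succAbove_ne _ _)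
    | cast i =>
      induction j using Fin.lastCases with
      | last =>
        simp only [place_succ_last, place_succ_castSucc] at hij
        exact absurd hij (Fin.succAbove_ne _ _)
      | cast j =>
        simp only [place_succ_castSucc] at hij
        rw [ih (Fin.succAbove_right_injective hij)]

/-- The mark of an early letter can be read off at any later time `n`, from its place at time `n`
and the erasers after `n`. `word_place` says the same of the letter itself; together they give
`ofPath_eq_placedSeq`. -/
lemma limitPosition_place (η : ∀ k : ℕ, Fin (k + 1)) (n : ℕ) (j : Fin (n + 1)) :
    limitPosition η n (place η n j) = limitPosition η j (η j) := by
  induction n with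
  | zero =>
    have hj : j = 0 := Subsingleton.elim (α := Fin 1) _ _
    subst hj
    rw [Subsingleton.elim (α := Fin 1) (place η 0 0) (η 0)]
    rfl
  | succ n ih =>
    induction j using Fin.lastCases with
    | last => simp
    | cast j =>
      rw [place_succ_castSucc, val_succAbove, limitPosition_succ, ih]
      simp

lemma word_place {A : Type u} {W : ∀ n : ℕ, Fin (n + 1) → A} {η : ∀ k : ℕ, Fin (k + 1)}
    (h : ∀ n, W n = erase (W (n + 1)) (η (n + 1))) (n : ℕ) (j : Fin (n + 1)) :
    W n (place η n j) = W j (η j) := by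
  induction n with
  | zero =>
    have hj : j = 0 := Subsingleton.elim (α := Fin 1) _ _
    subst hj
    rw [Subsingleton.elim (α := Fin 1) (place η 0 0) (η 0)]
    rfl
  | succ n ih =>
    induction j using Fin.lastCases with
    | last => simp
    | cast j =>
      rw [place_succ_castSucc]
      have := congrFun (h n) (place η n j)
      rw [erase] at this
      rw [← this, ih]
      simp

/-- The number of indices `k ≤ n` with `x k < a`. -/
noncomputable def countBelow (x : ℕ → ℝ) (n : ℕ) (a : ℝ) : ℕ :=
  ((Finset.range (n + 1)).filter (fun k => x k < a)).card

lemma countBelow_succ (x : ℕ → ℝ) (n : ℕ) (a : ℝ) :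
    countBelow x (n + 1) a = countBelow x n a + if x (n + 1) < a then 1 else 0 := by
  unfold countBelow
  rw [Finset.range_add_one, Finset.filter_insert]
  split_ifs <;> simp

lemma countBelow_succ_self (x : ℕ → ℝ) (n : ℕ) :
    countBelow x (n + 1) (x (n + 1)) = countBelow x n (x (n + 1)) := by
  simp [countBelow_succ]

lemma lastRank_eq_countBelow {x : ℕ → ℝ} (hx : Function.Injective x) (n : ℕ) :
    (lastRank n x : ℕ) = countBelow x n (x n) := by
  have : (Finset.range (n + 1)).filter (fun k => x k ≤ x n)
      = insert n ((Finset.range (n + 1)).filter (fun k => x k < x n)) := by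
    ext k
    simp only [Finset.mem_filter, Finset.mem_range, Finset.mem_insert, le_iff_lt_or_eq,
      hx.eq_iff]
    constructor
    · rintro ⟨h, h' | h'⟩
      · exact Or.inr ⟨h, h'⟩
      · exact Or.inl h'
    · rintro (h | h)
      · exact ⟨by omega, Or.inr h⟩
      · exact ⟨h.1, Or.inl h.2⟩
  simp only [lastRank, this, countBelow]
  rw [Finset.card_insert_of_notMem (by simp)]
  simp

lemma bump_countBelow {x : ℕ → ℝ} (hx : Function.Injective x) {n j : ℕ} (hj : j ≤ n) :
    bump (lastRank (n + 1) x) (countBelow x n (x j)) = countBelow x (n + 1) (x j) := by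
  rw [lastRank_eq_countBelow hx, countBelow_succ_self, countBelow_succ, bump]
  rcases lt_or_gt_of_ne (hx.ne (show n + 1 ≠ j by omega)) with h | h
  · rw [if_pos h, if_neg (not_lt.2 ?_)]
    refine Finset.card_le_card fun k hk => ?_
    simp only [Finset.mem_filter] at hk ⊢
    exact ⟨hk.1, hk.2.trans h⟩
  · rw [if_neg h.not_gt, if_pos, add_zero]
    -- The index `j` makes the inclusion strict: `x j` lies below `x (n + 1)` but not below itself.
    refine Finset.card_lt_card (Finset.ssubset_iff_of_subset ?_ |>.2 ⟨j, ?_, ?_⟩)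
    · intro k hk
      simp only [Finset.mem_filter] at hk ⊢
      exact ⟨hk.1, hk.2.trans h⟩
    · simpa [Nat.lt_succ_iff, hj] using h
    · simp

lemma push_countBelow {x : ℕ → ℝ} (hx : Function.Injective x) (j m : ℕ) (n : ℕ) (hj : j ≤ n) :
    push (fun k => lastRank k x) n m (countBelow x n (x j)) = countBelow x (n + m) (x j) := by
  induction m generalizing n with
  | zero => rfl
  | succ m ih =>
    rw [push, bump_countBelow hx hj, ih (n + 1) (by omega)]
    congr 1
    omega

/-- For distinct values the sorted sequence is strictly increasing, so the entries below `x j` are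
exactly those sorted into the positions before that of `x j`. -/
lemma val_sort_symm {n : ℕ} {x : Fin n → ℝ} (hx : Function.Injective x) (j : Fin n) :
    ((Tuple.sort x).symm j : ℕ) = (Finset.univ.filter (fun k => x k < x j)).card := by
  have hm : StrictMono (x ∘ Tuple.sort x) :=
    (Tuple.monotone_sort x).strictMono_of_injective (hx.comp (Tuple.sort x).injective)
  have : Finset.univ.filter (fun k => x k < x j)
      = (Finset.Iio ((Tuple.sort x).symm j)).map (Tuple.sort x).toEmbedding := by
    ext k
    simp only [Finset.mem_filter, Finset.mem_univ, true_and, Finset.mem_map_equiv, Finset.mem_Iio]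
    rw [← hm.lt_iff_lt]
    simp
  rw [this, Finset.card_map, Fin.card_Iio]

lemma val_sort_symm_eq_countBelow {x : ℕ → ℝ} (hx : Function.Injective x) {n : ℕ}
    (j : Fin (n + 1)) :
    ((Tuple.sort (fun i : Fin (n + 1) => x i)).symm j : ℕ) = countBelow x n (x j) := by
  rw [val_sort_symm (fun a b h => Fin.ext (hx h)), countBelow]
  refine Finset.card_bij (fun k _ => (k : ℕ)) ?_ ?_ ?_
  · intro k hk
    exact Finset.mem_filter.2 ⟨Finset.mem_range.2 k.2, (Finset.mem_filter.1 hk).2⟩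
  · intro a _ b _ h
    exact Fin.ext h
  · intro k hk
    simp only [Finset.mem_filter, Finset.mem_range] at hk
    exact ⟨⟨k, hk.1⟩, by simpa using hk.2, rfl⟩

lemma lastRank_eq_sort_symm {x : ℕ → ℝ} (hx : Function.Injective x) (n : ℕ) :
    lastRank n x = (Tuple.sort (fun i : Fin (n + 1) => x i)).symm (Fin.last n) := by
  refine Fin.ext ?_
  rw [lastRank_eq_countBelow hx, val_sort_symm_eq_countBelow hx, Fin.val_last]

/-- Inserting letters successively at their ranks is insertion sort. This links the dynamic
description by erasers to the static one by `Tuple.sort`. -/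
lemma place_lastRank {x : ℕ → ℝ} (hx : Function.Injective x) (n : ℕ) :
    place (fun k => lastRank k x) n = (Tuple.sort (fun i : Fin (n + 1) => x i)).symm := by
  induction n with
  | zero => exact funext fun j => Subsingleton.elim (α := Fin 1) _ _
  | succ n ih =>
    funext j
    induction j using Fin.lastCases with
    | last => rw [place_succ_last, lastRank_eq_sort_symm hx]
    | cast j =>
      refine Fin.ext ?_
      rw [place_succ_castSucc, val_succAbove, ih, val_sort_symm_eq_countBelow hx,
        val_sort_symm_eq_countBelow hx, bump_countBelow hx (Nat.lt_succ_iff.1 j.2)]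
      rfl

lemma word_apply_sort_symm {A : Type u} (y : ℕ → A) (x : ℕ → ℝ) (n : ℕ) (j : Fin (n + 1)) :
    word n y x ((Tuple.sort (fun i : Fin (n + 1) => x i)).symm j) = y j := by
  simp [word, inducedOrderStatistics]

lemma word_lastRank {A : Type u} (y : ℕ → A) {x : ℕ → ℝ} (hx : Function.Injective x) (n : ℕ) :
    word n y x (lastRank n x) = y n := by
  rw [lastRank_eq_sort_symm hx, word_apply_sort_symm, Fin.val_last]

lemma word_eq_erase {A : Type u} (y : ℕ → A) {x : ℕ → ℝ} (hx : Function.Injective x) (n : ℕ) :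
    word n y x = erase (word (n + 1) y x) (lastRank (n + 1) x) := by
  funext p
  obtain ⟨j, rfl⟩ := (Tuple.sort (fun i : Fin (n + 1) => x i)).symm.surjective p
  rw [erase, word_apply_sort_symm, ← place_lastRank hx, ← place_succ_castSucc
    (fun k => lastRank k x), place_lastRank hx, word_apply_sort_symm]
  rfl

lemma limitPosition_lastRank {x : ℕ → ℝ} (hx : Function.Injective x) (j : ℕ)
    (h : Filter.Tendsto (fun n : ℕ => (countBelow x n (x j) : ℝ) / ((n + 1 : ℕ) : ℝ))
      Filter.atTop (nhds (x j))) :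
    limitPosition (fun k => lastRank k x) j (lastRank j x) = x j := by
  unfold limitPosition
  simp only [lastRank_eq_countBelow hx, push_countBelow hx j _ j le_rfl]
  refine Filter.Tendsto.limsup_eq ?_
  have := h.comp (Filter.tendsto_add_atTop_nat j)
  simpa [Function.comp_def, add_comm, add_left_comm] using this

/-- Sorting forgets the order of the input. Distinctness matters, since ties are broken by index. -/
lemma word_comp_swap {A : Type u} (y : ℕ → A) {x : ℕ → ℝ} (hx : Function.Injective x)
    {n j k : ℕ} (hj : j ≤ n) (hk : k ≤ n) :
    word n (fun i => y (Equiv.swap j k i)) (fun i => x (Equiv.swap j k i)) = word n y x := by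
  set σ : Equiv.Perm (Fin (n + 1)) :=
    Equiv.swap ⟨j, Nat.lt_succ_iff.2 hj⟩ ⟨k, Nat.lt_succ_iff.2 hk⟩ with hσ
  have hval : ∀ i : Fin (n + 1), Equiv.swap j k i = (σ i : ℕ) := by
    intro i
    rw [hσ, Equiv.swap_apply_def, Equiv.swap_apply_def]
    simp only [Fin.ext_iff]
    split_ifs <;> rfl
  have hx' : Function.Injective (fun i : Fin (n + 1) => x i) := fun a b h => Fin.ext (hx h)
  funext i
  have := congrFun (Tuple.comp_perm_comp_sort_eq_comp_sort (f := fun i : Fin (n + 1) => x i)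
    (σ := σ)) i
  have h2 := hx' this
  simp only [word, inducedOrderStatistics, hval]
  rw [← h2]
  rfl

lemma lastRank_comp_swap (x : ℕ → ℝ) {n j k : ℕ} (hj : j < n) (hk : k < n) :
    lastRank n (fun i => x (Equiv.swap j k i)) = lastRank n x := by
  refine Fin.ext ?_
  simp only [lastRank]
  congr 1
  rw [Equiv.swap_apply_of_ne_of_ne hj.ne' hk.ne']
  have hmem : ∀ i, Equiv.swap j k i < n + 1 ↔ i < n + 1 := by
    intro i
    rw [Equiv.swap_apply_def]
    split_ifs <;> omega
  refine Finset.card_bij (fun i _ => Equiv.swap j k i) ?_ ?_ ?_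
  · intro i hi
    simpa [hmem] using hi
  · intro a _ b _ h
    exact (Equiv.swap j k).injective h
  · intro i hi
    exact ⟨Equiv.swap j k i, by simpa [hmem] using hi, by simp⟩

lemma lastRank_comp_swap_self {x : ℕ → ℝ} (hx : Function.Injective x) {n : ℕ}
    (j : Fin (n + 1)) :
    lastRank n (fun i => x (Equiv.swap (j : ℕ) n i))
      = (Tuple.sort (fun i : Fin (n + 1) => x i)).symm j := by
  refine Fin.ext ?_
  rw [lastRank_eq_countBelow (x := fun i => x (Equiv.swap (j : ℕ) n i))
    (hx.comp (Equiv.swap (j : ℕ) n).injective), val_sort_symm_eq_countBelow hx]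
  have hmem : ∀ i, Equiv.swap (j : ℕ) n i < n + 1 ↔ i < n + 1 := by
    intro i
    rw [Equiv.swap_apply_def]
    split_ifs <;> omega
  simp only [countBelow, Equiv.swap_apply_right]
  refine Finset.card_bij (fun i _ => Equiv.swap (j : ℕ) n i) ?_ ?_ ?_
  · intro i hi
    simpa [hmem] using hi
  · intro a _ b _ h
    exact (Equiv.swap (j : ℕ) n).injective h
  · intro i hi
    exact ⟨Equiv.swap (j : ℕ) n i, by simpa [hmem] using hi, by simp⟩

end Positions

/-! ### The two maps between paths and marked sequences. -/

section Maps

variable {A : Type u}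

/-- The path of words and ranks built from a sequence of letters with real marks. -/
noncomputable def toPath (x : ℕ → A × ℝ) : PathSpace A :=
  fun n => (word n (fun j => (x j).1) (fun j => (x j).2), lastRank n (fun j => (x j).2))

/-- The sequence of inserted letters, each marked with its asymptotic relative position. -/
noncomputable def ofPath (w : PathSpace A) : ℕ → A × ℝ :=
  fun j => ((w j).1 (w j).2, limitPosition (fun k => (w k).2) j (w j).2)

/-- Sequences of distinct reals in which every member is its own asymptotic relative rank. -/
def rankRegular : Set (ℕ → ℝ) :=
  {x | Function.Injective x ∧ ∀ j, Filter.Tendsto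
    (fun n : ℕ => (countBelow x n (x j) : ℝ) / ((n + 1 : ℕ) : ℝ)) Filter.atTop (nhds (x j))}

lemma ofPath_toPath {x : ℕ → A × ℝ} (hx : (fun j => (x j).2) ∈ rankRegular) :
    ofPath (toPath x) = x := by
  funext j
  refine Prod.ext ?_ ?_
  · exact word_lastRank (fun j => (x j).1) hx.1 j
  · exact limitPosition_lastRank hx.1 j (hx.2 j)

lemma toPath_ofPath {w : PathSpace A} (hw : ∀ n, (w n).1 = erase (w (n + 1)).1 (w (n + 1)).2)
    (hinj : Function.Injective (fun j => (ofPath w j).2))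
    (hrank : ∀ n, lastRank n (fun j => (ofPath w j).2) = (w n).2) :
    toPath (ofPath w) = w := by
  funext n
  refine Prod.ext ?_ (hrank n)
  funext p
  change word n (fun j => (ofPath w j).1) (fun j => (ofPath w j).2) p = (w n).1 p
  obtain ⟨j, rfl⟩ := (Tuple.sort (fun i : Fin (n + 1) => (ofPath w i).2)).symm.surjective p
  rw [word_apply_sort_symm _ (fun j => (ofPath w j).2), ← place_lastRank hinj]
  simp only [hrank]
  rw [word_place (W := fun n => (w n).1) hw]
  rfl

end Maps

/-! ### The tail σ-algebras of a process. -/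

section TailSigma

variable {Ω : Type v} {A : Type u} [MeasurableSpace A]

lemma tailSigma_antitone (W : ∀ n : ℕ, Ω → (Fin (n + 1) → A)) (η : ∀ n : ℕ, Ω → Fin (n + 1)) :
    Antitone (tailSigma W η) :=
  fun _ _ h => iSup₂_le fun k hk => le_iSup₂_of_le k (h.trans hk) le_rfl

lemma measurable_word_tailSigma (W : ∀ n : ℕ, Ω → (Fin (n + 1) → A))
    (η : ∀ n : ℕ, Ω → Fin (n + 1)) {n k : ℕ} (h : n ≤ k) : Measurable[tailSigma W η n] (W k) :=
  measurable_iff_comap_le.2 (le_iSup₂_of_le k h le_sup_left)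

lemma measurable_eraser_tailSigma (W : ∀ n : ℕ, Ω → (Fin (n + 1) → A))
    (η : ∀ n : ℕ, Ω → Fin (n + 1)) {n k : ℕ} (h : n ≤ k) :
    Measurable[tailSigma W η n] (η (k + 1)) :=
  measurable_iff_comap_le.2 (le_iSup₂_of_le k h le_sup_right)

end TailSigma

/-! ### Measurability of positions, sorting, ranks and the two maps. -/

section Measurability

variable {Ω : Type v} [MeasurableSpace Ω]

lemma measurable_push {η : ∀ n : ℕ, Ω → Fin (n + 1)} (m n : ℕ)
    (hη : ∀ k, n ≤ k → Measurable (η (k + 1))) {p : Ω → ℕ} (hp : Measurable p) :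
    Measurable (fun ω => push (fun k => η k ω) n m (p ω)) := by
  induction m generalizing n p with
  | zero => exact hp
  | succ m ih =>
    refine ih (n + 1) (fun k hk => hη k (by omega)) ?_
    have : Measurable (fun a : Fin (n + 2) × ℕ => bump a.1 a.2) := Measurable.of_discrete
    exact this.comp ((hη n le_rfl).prodMk hp)

lemma measurable_limitPosition {η : ∀ n : ℕ, Ω → Fin (n + 1)} (n : ℕ)
    (hη : ∀ k, n ≤ k → Measurable (η (k + 1))) {p : Ω → ℕ} (hp : Measurable p) :
    Measurable (fun ω => limitPosition (fun k => η k ω) n (p ω)) := by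
  refine Measurable.limsup fun m => ?_
  exact ((measurable_from_top (f := fun k : ℕ => (k : ℝ))).comp
    (measurable_push m n hη hp)).div_const _

lemma measurable_eval_fin {A : Type u} [MeasurableSpace A] {n : ℕ} {w : Ω → Fin n → A}
    {i : Ω → Fin n} (hw : Measurable w) (hi : Measurable i) : Measurable (fun ω => w ω (i ω)) := by
  have : Measurable (fun a : (Fin n → A) × Fin n => a.1 a.2) :=
    measurable_from_prod_countable_left fun i => measurable_pi_apply i
  exact this.comp (hw.prodMk hi)

/-- The stable sorting permutation is characterised by finitely many inequalities and tie conditions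
between coordinates. -/
lemma measurableSet_sort_eq (n : ℕ) (σ : Equiv.Perm (Fin n)) :
    MeasurableSet {x : Fin n → ℝ | Tuple.sort x = σ} := by
  have : {x : Fin n → ℝ | Tuple.sort x = σ} = {x | (∀ i j, i ≤ j → x (σ i) ≤ x (σ j)) ∧
      ∀ i j, i < j → x (σ i) = x (σ j) → σ i < σ j} := by
    ext x
    rw [Set.mem_ofPred_eq, eq_comm, Tuple.eq_sort_iff]
    rfl
  rw [this]
  simp only [Set.ofPred_and, Set.ofPred_forall]
  refine MeasurableSet.inter ?_ ?_
  · refine MeasurableSet.iInter fun i => MeasurableSet.iInter fun j => MeasurableSet.iInter fun _ =>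
      measurableSet_le (measurable_pi_apply _) (measurable_pi_apply _)
  · refine MeasurableSet.iInter fun i => MeasurableSet.iInter fun j => MeasurableSet.iInter fun _ =>
      ?_
    by_cases h : σ i < σ j
    · simp [h]
    · simp only [h, imp_false]
      exact (measurableSet_eq_fun (measurable_pi_apply (σ i)) (measurable_pi_apply (σ j))).compl

lemma measurable_sort_apply {n : ℕ} (i : Fin n) :
    Measurable (fun x : Fin n → ℝ => Tuple.sort x i) := by
  refine measurable_to_countable' fun j => ?_
  have : (fun x : Fin n → ℝ => Tuple.sort x i) ⁻¹' {j}
      = ⋃ σ : Equiv.Perm (Fin n), ⋃ _ : σ i = j, {x | Tuple.sort x = σ} := by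
    ext x
    simp
  rw [this]
  exact MeasurableSet.iUnion fun σ => MeasurableSet.iUnion fun _ => measurableSet_sort_eq n σ

lemma measurable_word {A : Type u} [MeasurableSpace A] (n : ℕ) :
    Measurable (fun x : ℕ → A × ℝ => word n (fun j => (x j).1) (fun j => (x j).2)) := by
  refine measurable_pi_lambda _ fun i => ?_
  refine measurable_eval_fin (w := fun (x : ℕ → A × ℝ) (j : Fin (n + 1)) => (x j).1)
    (i := fun (x : ℕ → A × ℝ) => Tuple.sort (fun j : Fin (n + 1) => (x j).2) i) ?_ ?_
  · fun_prop
  · refine (measurable_sort_apply i).comp ?_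
    fun_prop

lemma measurable_lastRank (n : ℕ) : Measurable (lastRank n) := by
  refine measurable_to_countable' fun i => ?_
  have h : Measurable (fun x : ℕ → ℝ =>
      ((Finset.range (n + 1)).filter (fun k => x k ≤ x n)).card - 1) := by
    simp only [Finset.card_filter]
    refine (measurable_from_top (f := fun k : ℕ => k - 1)).comp ?_
    refine Finset.measurable_sum _ fun k _ => ?_
    exact Measurable.ite (measurableSet_le (measurable_pi_apply _) (measurable_pi_apply _))
      measurable_const measurable_const
  have : lastRank n ⁻¹' {i} = (fun x : ℕ → ℝ =>
      ((Finset.range (n + 1)).filter (fun k => x k ≤ x n)).card - 1) ⁻¹' {(i : ℕ)} := by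
    ext x
    simp [lastRank, Fin.ext_iff]
  rw [this]
  exact h (measurableSet_singleton _)

variable {A : Type u} [MeasurableSpace A]

lemma measurable_toPath : Measurable (toPath (A := A)) := by
  refine measurable_pi_lambda _ fun n => (measurable_word n).prodMk ?_
  refine (measurable_lastRank n).comp ?_
  fun_prop

lemma measurable_ofPath : Measurable (ofPath (A := A)) := by
  refine measurable_pi_lambda _ fun j => Measurable.prodMk ?_ ?_
  · exact measurable_eval_fin (w := fun w : PathSpace A => (w j).1) (i := fun w => (w j).2)
      (by fun_prop) (by fun_prop)
  · refine measurable_limitPosition (η := fun k (w : PathSpace A) => (w k).2) j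
      (fun k _ => by fun_prop) ?_
    exact (measurable_from_top (f := fun i : Fin (j + 1) => (i : ℕ))).comp
      (by fun_prop : Measurable fun w : PathSpace A => (w j).2)

lemma tailSigma_le {W : ∀ n : ℕ, Ω → (Fin (n + 1) → A)} {η : ∀ n : ℕ, Ω → Fin (n + 1)}
    (hW : ∀ n, Measurable (W n)) (hη : ∀ n, Measurable (η n)) (n : ℕ) :
    tailSigma W η n ≤ ‹MeasurableSpace Ω› :=
  iSup₂_le fun k _ => sup_le (hW k).comap_le (hη (k + 1)).comap_le

end Measurability

/-! ### Pulling a GEWP back along a measurable map. -/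

section Transfer

variable {A : Type u} [MeasurableSpace A] {Ω : Type*} [MeasurableSpace Ω]
  {Ω' : Type*} [MeasurableSpace Ω']

lemma measurable_path {W : ∀ n : ℕ, Ω → (Fin (n + 1) → A)} {η : ∀ n : ℕ, Ω → Fin (n + 1)}
    (hW : ∀ n, Measurable (W n)) (hη : ∀ n, Measurable (η n)) :
    Measurable (fun ω n => (W n ω, η n ω) : Ω → PathSpace A) :=
  measurable_pi_lambda _ fun n => (hW n).prodMk (hη n)

lemma IsGEWP.comp {μ' : Measure Ω'} {W : ∀ n : ℕ, Ω' → (Fin (n + 1) → A)}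
    {η : ∀ n : ℕ, Ω' → Fin (n + 1)} (h : IsGEWP μ' W η) {μ : Measure Ω} {Z : Ω → Ω'}
    (hZ : Measurable Z) (hμ : μ.map Z = μ') :
    IsGEWP μ (fun n ω => W n (Z ω)) (fun n ω => η n (Z ω)) := by
  have := h.isProbabilityMeasure
  subst hμ
  refine ⟨Measure.isProbabilityMeasure_of_map Z, fun n => (h.measurable_word n).comp hZ,
    fun n => (h.measurable_eraser n).comp hZ, fun n i => ?_, fun n => ?_, fun n => ?_⟩
  · rw [← h.uniform n i, Measure.map_apply hZ (h.measurable_eraser n (measurableSet_singleton i))]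
    rfl
  · have htail : tailSigma (fun n ω => W n (Z ω)) (fun n ω => η n (Z ω)) n
        = (tailSigma W η n).comap Z := by
      simp only [tailSigma, MeasurableSpace.comap_iSup, MeasurableSpace.comap_sup,
        MeasurableSpace.comap_comp]
      rfl
    rw [htail, Indep_iff]
    rintro _ _ ⟨B, hB, rfl⟩ ⟨C, hC, rfl⟩
    have hC' : MeasurableSet C := tailSigma_le h.measurable_word h.measurable_eraser n _ hC
    have hB' : MeasurableSet (η n ⁻¹' B) := h.measurable_eraser n hB
    have := (Indep_iff _ _ _).1 (h.indep n) (η n ⁻¹' B) C ⟨B, hB, rfl⟩ hC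
    rw [Measure.map_apply hZ (hB'.inter hC'), Measure.map_apply hZ hB', Measure.map_apply hZ hC']
      at this
    exact this
  · exact ae_of_ae_map hZ.aemeasurable (h.erase_ae n)

end Transfer

/-! ### Exchangeable marked sequences produce GEWPs. -/

section Exchangeable

/-- Invariance of the law of a sequence under finite permutations. -/
def Exchangeable {E : Type*} [MeasurableSpace E] (Q : Measure (ℕ → E)) : Prop :=
  ∀ π : Equiv.Perm ℕ, (∃ n, ∀ k, n ≤ k → π k = k) → Q.map (fun x => x ∘ π) = Q

lemma measurable_comp_perm {E : Type*} [MeasurableSpace E] (π : ℕ → ℕ) :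
    Measurable (fun x : ℕ → E => x ∘ π) :=
  measurable_pi_lambda _ fun i => measurable_pi_apply (π i)

variable {A : Type u} [MeasurableSpace A]

lemma measurable_toPath_word (n : ℕ) : Measurable (fun x : ℕ → A × ℝ => (toPath x n).1) :=
  (measurable_fst.comp (measurable_pi_apply n)).comp measurable_toPath

lemma measurable_toPath_rank (n : ℕ) : Measurable (fun x : ℕ → A × ℝ => (toPath x n).2) :=
  (measurable_snd.comp (measurable_pi_apply n)).comp measurable_toPath

lemma comp_swap_mem_iff {n j : ℕ} (hj : j ≤ n) {C : Set (ℕ → A × ℝ)}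
    (hC : MeasurableSet[tailSigma (fun n x => (toPath x n).1) (fun n x => (toPath x n).2) n] C)
    {x : ℕ → A × ℝ} (hx : Function.Injective fun j => (x j).2) :
    x ∘ Equiv.swap j n ∈ C ↔ x ∈ C := by
  -- For the fixed sequence `x`, the sets that do not separate `x` from its swapped version form a
  -- σ-algebra, so generators suffice.
  let m : MeasurableSpace (ℕ → A × ℝ) :=
    { MeasurableSet' := fun C => x ∘ Equiv.swap j n ∈ C ↔ x ∈ C
      measurableSet_empty := by simp
      measurableSet_compl := fun s hs => by simp only [Set.mem_compl_iff, hs]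
      measurableSet_iUnion := fun f hf => by simp only [Set.mem_iUnion, hf] }
  have hle : tailSigma (fun n (x : ℕ → A × ℝ) => (toPath x n).1) (fun n x => (toPath x n).2) n
      ≤ m := by
    refine iSup₂_le fun k hk => sup_le ?_ ?_
    · rintro _ ⟨B, _, rfl⟩
      change word k (fun i => (x (Equiv.swap j n i)).1) (fun i => (x (Equiv.swap j n i)).2) ∈ B ↔
        word k (fun i => (x i).1) (fun i => (x i).2) ∈ B
      rw [word_comp_swap (fun i => (x i).1) hx (hj.trans hk) hk]
    · rintro _ ⟨B, _, rfl⟩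
      change lastRank (k + 1) (fun i => (x (Equiv.swap j n i)).2) ∈ B ↔
        lastRank (k + 1) (fun i => (x i).2) ∈ B
      rw [lastRank_comp_swap (fun i => (x i).2) (by omega) (by omega)]
  exact hle C hC

/-- Swapping `j` and `n` turns the event that the last term has rank `i` into the event that term
`j` does, and leaves the tail event `C` unchanged. For `j ≤ n` the latter events partition the
space, so each takes the same share of `C`. -/
lemma Exchangeable.measure_rank_inter {Q : Measure (ℕ → A × ℝ)} (hQ : Exchangeable Q)
    (hinj : ∀ᵐ x ∂Q, Function.Injective fun j => (x j).2) (n : ℕ) (i : Fin (n + 1))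
    {C : Set (ℕ → A × ℝ)}
    (hC : MeasurableSet[tailSigma (fun n x => (toPath x n).1) (fun n x => (toPath x n).2) n] C) :
    Q ((fun x => (toPath x n).2) ⁻¹' {i} ∩ C) = ((n : ℝ≥0∞) + 1)⁻¹ * Q C := by
  have hC' : MeasurableSet C :=
    tailSigma_le measurable_toPath_word measurable_toPath_rank n _ hC
  let f : (ℕ → A × ℝ) → Fin (n + 1) := fun x => Tuple.sort (fun j : Fin (n + 1) => (x j).2) i
  have hf : Measurable f := (measurable_sort_apply i).comp (by fun_prop)
  have hterm : ∀ j : Fin (n + 1),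
      Q.restrict C (f ⁻¹' {j}) = Q ((fun x => (toPath x n).2) ⁻¹' {i} ∩ C) := by
    intro j
    have hms : MeasurableSet ((fun x : ℕ → A × ℝ => (toPath x n).2) ⁻¹' {i} ∩ C) :=
      (measurable_toPath_rank n (measurableSet_singleton i)).inter hC'
    rw [Measure.restrict_apply (hf (measurableSet_singleton j))]
    conv_rhs => rw [← hQ (Equiv.swap (j : ℕ) n) ⟨n + 1, fun k hk =>
      Equiv.swap_apply_of_ne_of_ne (by omega) (by omega)⟩,
      Measure.map_apply (measurable_comp_perm _) hms]
    refine measure_congr ?_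
    filter_upwards [hinj] with x hx
    refine propext (and_congr ?_ (comp_swap_mem_iff (Nat.lt_succ_iff.1 j.2) hC hx).symm)
    change Tuple.sort _ i = j ↔ lastRank n (fun k => (x (Equiv.swap (j : ℕ) n k)).2) = i
    rw [lastRank_comp_swap_self hx, Equiv.symm_apply_eq, eq_comm]
  have hsum := sum_measure_preimage_singleton (μ := Q.restrict C) (Finset.univ : Finset (Fin (n + 1)))
    (f := f) (fun y _ => hf (measurableSet_singleton y))
  simp only [hterm, Finset.sum_const, Finset.card_univ, Fintype.card_fin, Finset.coe_univ,
    Set.preimage_univ, Measure.restrict_apply_univ, nsmul_eq_mul] at hsum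
  rw [← hsum, ← mul_assoc]
  push_cast
  rw [ENNReal.inv_mul_cancel (by simp) (by finiteness), one_mul]

theorem Exchangeable.isGEWP {Q : Measure (ℕ → A × ℝ)} [IsProbabilityMeasure Q]
    (hQ : Exchangeable Q) (hinj : ∀ᵐ x ∂Q, Function.Injective fun j => (x j).2) :
    IsGEWP Q (fun n x => (toPath x n).1) (fun n x => (toPath x n).2) := by
  have huniv : ∀ n (i : Fin (n + 1)),
      Q ((fun x => (toPath x n).2) ⁻¹' {i}) = ((n : ℝ≥0∞) + 1)⁻¹ := by
    intro n i
    simpa using hQ.measure_rank_inter hinj n i (MeasurableSet.univ)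
  refine ⟨inferInstance, measurable_toPath_word, measurable_toPath_rank, huniv, fun n => ?_,
    fun n => ?_⟩
  · rw [Indep_iff]
    rintro _ C ⟨B, hB, rfl⟩ hC
    have hm := measurable_toPath_rank (A := A) n
    have h1 := sum_measure_preimage_singleton (μ := Q.restrict C) B.toFinite.toFinset
      (f := fun x => (toPath x n).2) (fun y _ => hm (measurableSet_singleton y))
    have h2 := sum_measure_preimage_singleton (μ := Q) B.toFinite.toFinset
      (f := fun x => (toPath x n).2) (fun y _ => hm (measurableSet_singleton y))
    rw [Set.Finite.coe_toFinset] at h1 h2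
    rw [← Measure.restrict_apply (hm hB), ← h1, ← h2, Finset.sum_mul]
    refine Finset.sum_congr rfl fun i _ => ?_
    rw [Measure.restrict_apply (hm (measurableSet_singleton i)),
      hQ.measure_rank_inter hinj n i hC, huniv]
  · filter_upwards [hinj] with x hx
    exact word_eq_erase (fun j => (x j).1) hx n

end Exchangeable

/-! ### Exchangeable laws, the shift and product measures. -/

section Sequences

variable {E : Type*} [MeasurableSpace E]

/-- A measure on sequences is a product measure if it factorizes on initial boxes. -/
lemma eq_infinitePi_of_initial {X : ℕ → Type*} [∀ n, MeasurableSpace (X n)]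
    (μ : ∀ n, Measure (X n)) [∀ n, IsProbabilityMeasure (μ n)] {ν : Measure (∀ n, X n)}
    (h : ∀ (n : ℕ) (t : ∀ k, Set (X k)), (∀ k, MeasurableSet (t k)) →
      ν {x | ∀ k < n, x k ∈ t k} = ∏ k ∈ Finset.range n, μ k (t k)) :
    ν = Measure.infinitePi μ := by
  classical
  refine Measure.eq_infinitePi μ fun s t ht => ?_
  obtain ⟨n, hn⟩ := s.exists_nat_subset_range
  have hs := h n (fun k => if k ∈ s then t k else Set.univ) fun k => by
    split_ifs
    exacts [ht k, MeasurableSet.univ]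
  have h1 : {x : ∀ n, X n | ∀ k < n, x k ∈ if k ∈ s then t k else Set.univ} = Set.pi s t := by
    ext x
    simp only [Set.mem_ofPred_eq, Set.mem_pi, Finset.mem_coe]
    refine ⟨fun hx k hk => ?_, fun hx k _ => ?_⟩
    · simpa [hk] using hx k (Finset.mem_range.1 (hn hk))
    · split_ifs with hk
      exacts [hx k hk, trivial]
  rw [← h1, hs, ← Finset.prod_subset hn]
  · exact Finset.prod_congr rfl fun k hk => by rw [if_pos hk]
  · intro k _ hk
    rw [if_neg hk, measure_univ]

/-- The shift of sequences. -/
def shift (x : ℕ → E) : ℕ → E := fun n => x (n + 1)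

lemma measurable_shift : Measurable (shift (E := E)) :=
  measurable_pi_lambda _ fun n => measurable_pi_apply (n + 1)

/-- A finite permutation may act as the successor function on an initial segment. -/
lemma exists_perm_eq_succ (n : ℕ) :
    ∃ π : Equiv.Perm ℕ, (∃ m, ∀ k, m ≤ k → π k = k) ∧ ∀ k < n, π k = k + 1 := by
  refine ⟨⟨fun k => if k < n then k + 1 else if k = n then 0 else k,
    fun k => if k = 0 then n else if k ≤ n then k - 1 else k, fun k => ?_, fun k => ?_⟩,
    ⟨n + 1, fun k hk => ?_⟩, fun k hk => ?_⟩
  · grind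
  · grind
  · have h1 : ¬ k < n := by omega
    have h2 : k ≠ n := by omega
    simp [h1, h2]
  · simp [hk]

/-- On finitely many coordinates the shift agrees with a finite permutation, and finite-dimensional
marginals determine a finite measure. -/
lemma Exchangeable.map_shift {Q : Measure (ℕ → E)} [IsFiniteMeasure Q] (hQ : Exchangeable Q) :
    Q.map shift = Q := by
  refine IsProjectiveLimit.unique (P := fun I : Finset ℕ => Q.map I.restrict) (fun I => ?_)
    (fun I => rfl)
  obtain ⟨n, hn⟩ := I.exists_nat_subset_range
  obtain ⟨π, hπ, hlt⟩ := exists_perm_eq_succ n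
  conv_rhs => rw [← hQ π hπ]
  beta_reduce
  rw [Measure.map_map (by fun_prop) measurable_shift,
    Measure.map_map (by fun_prop) (measurable_comp_perm _)]
  congr 1
  funext x i
  simp only [Function.comp_apply, Finset.restrict, shift]
  rw [hlt i (Finset.mem_range.1 (hn i.2))]

lemma exchangeable_infinitePi (ρ : Measure E) [IsProbabilityMeasure ρ] :
    Exchangeable (Measure.infinitePi fun _ : ℕ => ρ) :=
  fun π _ => Measure.map_infinitePi_infinitePi_of_inj (P := fun _ : ℕ => ρ) π.injective

/-- Bernoulli shifts are ergodic. -/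
lemma ergodic_shift (ρ : Measure E) [IsProbabilityMeasure ρ] :
    Ergodic shift (Measure.infinitePi fun _ : ℕ => ρ) := by
  refine ⟨⟨measurable_shift, (exchangeable_infinitePi ρ).map_shift⟩, ⟨fun s hs hinv => ?_⟩⟩
  have hind : iIndepFun (fun (n : ℕ) (x : ℕ → E) => x n) (Measure.infinitePi fun _ : ℕ => ρ) :=
    iIndepFun_infinitePi (X := fun _ x => x) fun _ => measurable_id
  have hiter : ∀ n, (fun x : ℕ → E => fun k => x (k + n)) ⁻¹' s = s := by
    intro n
    induction n with
    | zero => rfl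
    | succ n ih =>
      conv_rhs => rw [← hinv, ← ih]
      rfl
  have htail : MeasurableSet[Filter.limsup
      (fun n : ℕ => MeasurableSpace.comap (fun x : ℕ → E => x n) inferInstance) Filter.atTop] s := by
    rw [Filter.limsup_eq_iInf_iSup_of_nat]
    rw [MeasurableSpace.measurableSet_iInf]
    intro n
    -- An invariant set equals its preimage under the `n`-fold shift, which involves only
    -- coordinates from `n` on; thus it is a tail event and Kolmogorov's 0-1 law applies.
    rw [← hiter n]
    refine @measurable_pi_lambda _ _ _ (_) _ _ (fun k => ?_) _ hs
    exact measurable_iff_comap_le.2 (le_iSup₂_of_le (k + n) (Nat.le_add_left n k) le_rfl)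
  rcases measure_zero_or_one_of_measurableSet_limsup_atTop
    (fun n => (measurable_pi_apply n).comap_le) hind htail with h | h
  · exact Filter.eventuallyConst_set'.2 (Or.inl (measure_eq_zero_iff_ae_notMem.1 h |>.mono
      fun x hx => propext (iff_false_intro hx)))
  · refine Filter.eventuallyConst_set'.2 (Or.inr ?_)
    have := (prob_compl_eq_zero_iff hs).2 h
    filter_upwards [measure_eq_zero_iff_ae_notMem.1 this] with x hx
    exact propext (iff_true_intro (not_not.1 hx))

/-- Product measures are extremal among the exchangeable laws. -/
lemma Exchangeable.eq_infinitePi_of_absolutelyContinuous {ρ : Measure E} [IsProbabilityMeasure ρ]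
    {Q : Measure (ℕ → E)} [IsProbabilityMeasure Q] (hQ : Exchangeable Q)
    (h : Q ≪ Measure.infinitePi fun _ : ℕ => ρ) : Q = Measure.infinitePi fun _ : ℕ => ρ :=
  (ergodic_shift ρ).eq_of_absolutelyContinuous ⟨measurable_shift, hQ.map_shift⟩ h

/-- An exchangeable law for which the first coordinate is independent of the shifted sequence is
a product measure. -/
lemma Exchangeable.eq_infinitePi_of_factorizes {Q : Measure (ℕ → E)} [IsProbabilityMeasure Q]
    (h : ∀ (B : Set E) (C : Set (ℕ → E)), MeasurableSet B → MeasurableSet C →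
      Q {x | x 0 ∈ B ∧ shift x ∈ C} = Q {x | x 0 ∈ B} * Q C) :
    Q = Measure.infinitePi fun _ : ℕ => Q.map fun x => x 0 := by
  have : IsProbabilityMeasure (Q.map fun x => x 0) :=
    Measure.isProbabilityMeasure_map (measurable_pi_apply 0).aemeasurable
  refine eq_infinitePi_of_initial _ fun n => ?_
  induction n with
  | zero => simp
  | succ n ih =>
    intro t ht
    have hset : {x : ℕ → E | ∀ k < n + 1, x k ∈ t k}
        = {x | x 0 ∈ t 0 ∧ shift x ∈ {y : ℕ → E | ∀ k < n, y k ∈ t (k + 1)}} := by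
      ext x
      simp only [Set.mem_ofPred_eq, shift]
      refine ⟨fun hx => ⟨hx 0 (by omega), fun k hk => hx (k + 1) (by omega)⟩, ?_⟩
      rintro ⟨h0, hx⟩ k hk
      cases k with
      | zero => exact h0
      | succ k => exact hx k (by omega)
    rw [hset, h _ _ (ht 0), ih (fun k => t (k + 1)) (fun k => ht _), Finset.prod_range_succ',
      mul_comm, Measure.map_apply (by fun_prop) (ht 0)]
    · rfl
    · simp only [Set.ofPred_forall]
      exact MeasurableSet.iInter fun k => MeasurableSet.iInter fun _ =>
        measurable_pi_apply k (ht _)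

end Sequences

/-! ### Strong law of large numbers for ranks of uniform variables. -/

section UniformSequence

/-- The uniform distribution on the unit interval, as a measure on the real line. -/
noncomputable abbrev unif : Measure ℝ := volume.restrict (Set.Icc (0 : ℝ) 1)

instance : IsProbabilityMeasure unif := ⟨by simp⟩

lemma unif_real_Iio_le {q : ℝ} (hq : 0 ≤ q) : unif.real (Set.Iio q) ≤ q := by
  rw [measureReal_restrict_apply measurableSet_Iio]
  calc volume.real (Set.Iio q ∩ Set.Icc 0 1) ≤ volume.real (Set.Icc 0 q) :=
        measureReal_mono (fun x hx => ⟨hx.2.1, hx.1.le⟩) (by simp)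
    _ = q := by simp [hq]

lemma le_unif_real_Iio {q : ℝ} (hq : q ≤ 1) : q ≤ unif.real (Set.Iio q) := by
  rw [measureReal_restrict_apply measurableSet_Iio]
  calc q ≤ volume.real (Set.Ico 0 q) := by simp [Real.volume_real_Ico]
    _ ≤ volume.real (Set.Iio q ∩ Set.Icc 0 1) :=
        measureReal_mono (fun x hx => ⟨hx.2, hx.1, hx.2.le.trans hq⟩)
          ((measure_mono Set.inter_subset_right).trans_lt (by simp)).ne

lemma ae_injective_infinitePi (ν : Measure ℝ) [IsProbabilityMeasure ν] [NullSingletonClass ν] :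
    ∀ᵐ x ∂(Measure.infinitePi fun _ : ℕ => ν), Function.Injective x := by
  have h : ∀ i j : ℕ, i ≠ j → ∀ᵐ x ∂(Measure.infinitePi fun _ : ℕ => ν), x i ≠ x j := by
    intro i j hij
    have hm : MeasurableSet {p : ℝ × ℝ | p.1 = p.2} :=
      measurableSet_eq_fun measurable_fst measurable_snd
    have h1 : ∀ᵐ p ∂(ν.prod ν), p.1 ≠ p.2 := by
      rw [Measure.ae_prod_iff_ae_ae (p := fun p : ℝ × ℝ => p.1 ≠ p.2) hm.compl]
      refine Filter.Eventually.of_forall fun a => ?_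
      filter_upwards [measure_eq_zero_iff_ae_notMem.1 (measure_singleton (μ := ν) a)] with b hb
      exact fun hab => hb hab.symm
    rw [← Measure.infinitePi_map_eval_prod (P := fun _ : ℕ => ν) hij] at h1
    exact ae_of_ae_map (f := fun x : ℕ → ℝ => (x i, x j)) (p := fun p => p.1 ≠ p.2)
      (by fun_prop) h1
  have h' : ∀ᵐ x ∂(Measure.infinitePi fun _ : ℕ => ν), ∀ i j : ℕ, i ≠ j → x i ≠ x j := by
    simpa only [ae_all_iff] using h
  filter_upwards [h'] with x hx i j hij
  by_contra hne
  exact hx i j hne hij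

lemma ae_tendsto_countBelow (ν : Measure ℝ) [IsProbabilityMeasure ν] (q : ℝ) :
    ∀ᵐ x ∂(Measure.infinitePi fun _ : ℕ => ν),
      Filter.Tendsto (fun n : ℕ => (countBelow x n q : ℝ) / ((n + 1 : ℕ) : ℝ)) Filter.atTop
        (nhds (ν.real (Set.Iio q))) := by
  let g : ℝ → ℝ := (Set.Iio q).indicator 1
  have hg : Measurable g := measurable_one.indicator measurableSet_Iio
  have hident : ∀ i : ℕ, IdentDistrib (fun x : ℕ → ℝ => x i) (fun x : ℕ → ℝ => x 0)
      (Measure.infinitePi fun _ : ℕ => ν) (Measure.infinitePi fun _ : ℕ => ν) := fun i =>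
    ⟨(measurable_pi_apply i).aemeasurable, (measurable_pi_apply 0).aemeasurable, by
      rw [Measure.infinitePi_map_eval, Measure.infinitePi_map_eval]⟩
  have hint : ∫ x, g (x 0) ∂(Measure.infinitePi fun _ : ℕ => ν) = ν.real (Set.Iio q) := by
    rw [← integral_indicator_one measurableSet_Iio,
      ← integral_map (μ := Measure.infinitePi fun _ : ℕ => ν)
        (measurable_pi_apply 0).aemeasurable hg.aestronglyMeasurable,
      Measure.infinitePi_map_eval]
  have := strong_law_ae_real (μ := Measure.infinitePi fun _ : ℕ => ν)
    (fun i x => g (x i)) ?_ ?_ fun i => (hident i).comp hg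
  · rw [hint] at this
    filter_upwards [this] with x hx
    refine ((Filter.tendsto_add_atTop_iff_nat 1).2 hx).congr fun n => ?_
    congr 1
    simp only [g, countBelow, Finset.card_filter, Set.indicator_apply, Set.mem_Iio]
    push_cast
    rfl
  · refine Integrable.of_bound (hg.comp (measurable_pi_apply 0)).aestronglyMeasurable 1
      (Filter.Eventually.of_forall fun x => ?_)
    simp only [g, Set.indicator_apply]
    split_ifs <;> simp
  · intro i j hij
    exact (iIndepFun_infinitePi (P := fun _ : ℕ => ν) (X := fun _ => g) fun _ => hg).indepFun hij

lemma countBelow_mono (x : ℕ → ℝ) (n : ℕ) {a b : ℝ} (h : a ≤ b) :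
    countBelow x n a ≤ countBelow x n b :=
  Finset.card_le_card fun _ hk =>
    Finset.mem_filter.2 ⟨(Finset.mem_filter.1 hk).1, (Finset.mem_filter.1 hk).2.trans_le h⟩

/-- Independent uniform variables are distinct and satisfy the law of large numbers for ranks. -/
theorem ae_mem_rankRegular :
    ∀ᵐ x ∂(Measure.infinitePi fun _ : ℕ => unif), x ∈ rankRegular := by
  have h01 : ∀ᵐ x ∂(Measure.infinitePi fun _ : ℕ => unif), ∀ j : ℕ, x j ∈ Set.Icc (0 : ℝ) 1 := by
    rw [ae_all_iff]
    intro j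
    have h1 : ∀ᵐ a ∂unif, a ∈ Set.Icc (0 : ℝ) 1 := ae_restrict_mem measurableSet_Icc
    rw [← Measure.infinitePi_map_eval (fun _ : ℕ => unif) j] at h1
    exact ae_of_ae_map (measurable_pi_apply j).aemeasurable h1
  have hq : ∀ᵐ x ∂(Measure.infinitePi fun _ : ℕ => unif), ∀ q : ℚ,
      Filter.Tendsto (fun n : ℕ => (countBelow x n q : ℝ) / ((n + 1 : ℕ) : ℝ)) Filter.atTop
        (nhds (unif.real (Set.Iio (q : ℝ)))) :=
    ae_all_iff.2 fun q => ae_tendsto_countBelow unif q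
  filter_upwards [ae_injective_infinitePi unif, h01, hq] with x hinj hx hlim
  -- The strong law holds almost surely at all rational thresholds at once. The random threshold `x
  -- j` is squeezed between rationals by monotonicity of `countBelow`.
  refine ⟨hinj, fun j => tendsto_order.2 ⟨fun a ha => ?_, fun b hb => ?_⟩⟩
  · obtain ⟨q, haq, hqx⟩ := exists_rat_btwn ha
    have hlt : a < unif.real (Set.Iio (q : ℝ)) :=
      haq.trans_le (le_unif_real_Iio (hqx.le.trans (hx j).2))
    filter_upwards [(hlim q).eventually (lt_mem_nhds hlt)] with n hn
    refine hn.trans_le ?_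
    gcongr
    exact countBelow_mono x n hqx.le
  · obtain ⟨q, hxq, hqb⟩ := exists_rat_btwn hb
    have hlt : unif.real (Set.Iio (q : ℝ)) < b :=
      (unif_real_Iio_le ((hx j).1.trans hxq.le)).trans_lt hqb
    filter_upwards [(hlim q).eventually (gt_mem_nhds hlt)] with n hn
    refine lt_of_le_of_lt ?_ hn
    gcongr
    exact countBelow_mono x n hxq.le

end UniformSequence

/-! ### The joint law of the erasers and of the induced placements. -/

section Erasers

variable {A : Type u} [MeasurableSpace A] {Ω : Type v} [MeasurableSpace Ω] {μ : Measure Ω}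
  {W : ∀ n : ℕ, Ω → (Fin (n + 1) → A)} {η : ∀ n : ℕ, Ω → Fin (n + 1)}

/-- The uniform distribution on the positions in the word with index `n`. -/
noncomputable def eraserLaw (n : ℕ) : Measure (Fin (n + 1)) := ((n : ℝ≥0∞) + 1)⁻¹ • Measure.count

instance (n : ℕ) : IsProbabilityMeasure (eraserLaw n) := by
  refine ⟨?_⟩
  simp only [eraserLaw, Measure.smul_apply, smul_eq_mul]
  rw [← Finset.coe_univ, Measure.count_apply_finset]
  simp only [Finset.card_univ, Fintype.card_fin]
  push_cast
  exact ENNReal.inv_mul_cancel (by simp) (by finiteness)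

lemma IsGEWP.map_eraser (h : IsGEWP μ W η) (n : ℕ) : μ.map (η n) = eraserLaw n := by
  refine Measure.ext_of_singleton fun i => ?_
  rw [Measure.map_apply (h.measurable_eraser n) (measurableSet_singleton i), h.uniform]
  simp [eraserLaw]

lemma IsGEWP.measure_eraser_inter (h : IsGEWP μ W η) (n : ℕ) (B : Set (Fin (n + 1))) {C : Set Ω}
    (hC : MeasurableSet[tailSigma W η n] C) : μ (η n ⁻¹' B ∩ C) = eraserLaw n B * μ C := by
  have hB : MeasurableSet B := B.toFinite.measurableSet
  rw [(Indep_iff _ _ _).1 (h.indep n) _ C ⟨B, hB, rfl⟩ hC, ← h.map_eraser,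
    Measure.map_apply (h.measurable_eraser n) hB]

/-- The eraser `η (n + 1)` is measurable for the tail at `n`, so its event can be absorbed into `C`
before the induction hypothesis is applied. -/
lemma IsGEWP.measure_erasers_inter (h : IsGEWP μ W η) (t : ∀ n : ℕ, Set (Fin (n + 1))) (n : ℕ)
    {C : Set Ω} (hC : MeasurableSet[tailSigma W η n] C) :
    μ ({ω | ∀ k < n + 1, η k ω ∈ t k} ∩ C)
      = (∏ k ∈ Finset.range (n + 1), eraserLaw k (t k)) * μ C := by
  induction n generalizing C with
  | zero =>
    rw [zero_add, Finset.prod_range_one, ← h.measure_eraser_inter 0 (t 0) hC]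
    congr 1
    ext ω
    simp
  | succ n ih =>
    have hset : {ω | ∀ k < n + 1 + 1, η k ω ∈ t k} ∩ C
        = {ω | ∀ k < n + 1, η k ω ∈ t k} ∩ (η (n + 1) ⁻¹' t (n + 1) ∩ C) := by
      ext ω
      simp only [Set.mem_inter_iff, Set.mem_ofPred_eq, Set.mem_preimage]
      constructor
      · rintro ⟨hk, hc⟩
        exact ⟨fun k hk' => hk k (by omega), hk _ (by omega), hc⟩
      · rintro ⟨hk, hn, hc⟩
        refine ⟨fun k hk' => ?_, hc⟩
        rcases Nat.lt_succ_iff_lt_or_eq.1 hk' with h' | rfl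
        exacts [hk k h', hn]
    rw [hset, ih, h.measure_eraser_inter _ _ hC, Finset.prod_range_succ _ (n + 1), mul_assoc]
    exact (measurable_eraser_tailSigma W η le_rfl (t (n + 1)).toFinite.measurableSet).inter
      (tailSigma_antitone W η n.le_succ _ hC)

/-- The erasers are independent and uniformly distributed. -/
theorem IsGEWP.map_erasers (h : IsGEWP μ W η) :
    μ.map (fun ω n => η n ω) = Measure.infinitePi eraserLaw := by
  have := h.isProbabilityMeasure
  have hm := h.measurable_eraser
  refine eq_infinitePi_of_initial _ fun n t ht => ?_
  rw [Measure.map_apply (measurable_pi_lambda _ hm)]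
  · cases n with
    | zero => simp
    | succ n =>
      have := h.measure_erasers_inter t n MeasurableSet.univ
      rw [Set.inter_univ, measure_univ, mul_one] at this
      exact this
  · simp only [Set.ofPred_forall]
    exact MeasurableSet.iInter fun k => MeasurableSet.iInter fun _ =>
      measurable_pi_apply k (ht k)

lemma measurable_place (hη : ∀ n, Measurable (η n)) (n : ℕ) (j : Fin (n + 1)) :
    Measurable (fun ω => place (fun k => η k ω) n j) := by
  induction n with
  | zero => exact measurable_const
  | succ n ih =>
    induction j using Fin.lastCases with
    | last => simpa using hη (n + 1)
    | cast j =>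
      simp only [place_succ_castSucc]
      have : Measurable (fun a : Fin (n + 2) × Fin (n + 1) => a.1.succAbove a.2) :=
        Measurable.of_discrete
      exact this.comp ((hη (n + 1)).prodMk (ih j))

/-- The placement of the first letters is a uniform random permutation, independent of the
future. -/
lemma IsGEWP.measure_place_inter (h : IsGEWP μ W η) (n : ℕ) {s : Fin (n + 1) → Fin (n + 1)}
    (hs : Function.Injective s) {C : Set Ω} (hC : MeasurableSet[tailSigma W η n] C) :
    μ ({ω | place (fun k => η k ω) n = s} ∩ C) = ((n + 1)! : ℝ≥0∞)⁻¹ * μ C := by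
  induction n generalizing C with
  | zero =>
    have : {ω | place (fun k => η k ω) 0 = s} = Set.univ :=
      Set.eq_univ_of_forall fun ω => funext fun j => Subsingleton.elim (α := Fin 1) _ _
    simp [this]
  | succ n ih =>
    have hne : ∀ j : Fin (n + 1), s j.castSucc ≠ s (Fin.last (n + 1)) := fun j hj =>
      (Fin.castSucc_lt_last j).ne (hs hj)
    -- Deleting the value taken at the last index from `s` leaves the placement `s'` of the earlier
    -- letters.
    choose s' hs' using fun j => Fin.exists_succAbove_eq (hne j)
    have hinj : Function.Injective s' := by
      intro i j hij
      refine Fin.castSucc_injective _ (hs ?_)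
      rw [← hs', ← hs', hij]
    have hset : {ω | place (fun k => η k ω) (n + 1) = s} ∩ C
        = {ω | place (fun k => η k ω) n = s'} ∩ (η (n + 1) ⁻¹' {s (Fin.last (n + 1))} ∩ C) := by
      ext ω
      simp only [Set.mem_inter_iff, Set.mem_ofPred_eq, Set.mem_preimage, Set.mem_singleton_iff]
      constructor
      · rintro ⟨hp, hc⟩
        have hlast := congrFun hp (Fin.last (n + 1))
        rw [place_succ_last] at hlast
        refine ⟨funext fun j => ?_, hlast, hc⟩
        have := congrFun hp j.castSucc
        rw [place_succ_castSucc, hlast, ← hs'] at this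
        exact Fin.succAbove_right_injective this
      · rintro ⟨hp, hlast, hc⟩
        refine ⟨funext fun j => ?_, hc⟩
        induction j using Fin.lastCases with
        | last => rw [place_succ_last, hlast]
        | cast j => rw [place_succ_castSucc, hlast, hp, hs']
    rw [hset, ih hinj, (Indep_iff _ _ _).1 (h.indep (n + 1)) _ C
      ⟨_, measurableSet_singleton _, rfl⟩ hC, h.uniform, ← mul_assoc, Nat.factorial_succ (n + 1)]
    · push_cast
      rw [ENNReal.mul_inv (by simp) (by simp), mul_comm (_⁻¹) (_⁻¹)]
    · exact (measurable_eraser_tailSigma W η le_rfl (measurableSet_singleton _)).inter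
        (tailSigma_antitone W η n.le_succ _ hC)

end Erasers

/-! ### Exchangeability of the marked sequence. -/

section MarkedSequence

variable {A : Type u} {Ω : Type v}

/-- The marked sequence which arises when the first `n + 1` letters have places `s`. -/
noncomputable def placedSeq (W : ∀ n : ℕ, Ω → (Fin (n + 1) → A)) (η : ∀ n : ℕ, Ω → Fin (n + 1))
    (n : ℕ) (s : Fin (n + 1) → Fin (n + 1)) (ω : Ω) : ℕ → A × ℝ :=
  fun j => if h : j < n + 1 then
      (W n ω (s ⟨j, h⟩), limitPosition (fun k => η k ω) n (s ⟨j, h⟩))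
    else ofPath (fun k => (W k ω, η k ω)) j

lemma ofPath_eq_placedSeq {W : ∀ n : ℕ, Ω → (Fin (n + 1) → A)} {η : ∀ n : ℕ, Ω → Fin (n + 1)}
    {ω : Ω} (h : ∀ n, W n ω = erase (W (n + 1) ω) (η (n + 1) ω)) (n : ℕ) :
    ofPath (fun k => (W k ω, η k ω)) = placedSeq W η n (place (fun k => η k ω) n) ω := by
  funext j
  unfold placedSeq
  split_ifs with hj
  · refine Prod.ext ?_ ?_
    · exact (word_place (W := fun n => W n ω) (η := fun n => η n ω) h n ⟨j, hj⟩).symm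
    · exact (limitPosition_place (fun k => η k ω) n ⟨j, hj⟩).symm
  · rfl

variable [MeasurableSpace A]

lemma measurable_placedSeq (W : ∀ n : ℕ, Ω → (Fin (n + 1) → A)) (η : ∀ n : ℕ, Ω → Fin (n + 1))
    (n : ℕ) (s : Fin (n + 1) → Fin (n + 1)) :
    Measurable[tailSigma W η n] (placedSeq W η n s) := by
  let _ : MeasurableSpace Ω := tailSigma W η n
  have hη : ∀ k, n ≤ k → Measurable (η (k + 1)) := fun k hk => measurable_eraser_tailSigma W η hk
  have hW : ∀ k, n ≤ k → Measurable (W k) := fun k hk => measurable_word_tailSigma W η hk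
  refine measurable_pi_lambda _ fun j => ?_
  unfold placedSeq
  split_ifs with hj
  · exact ((measurable_pi_apply _).comp (hW n le_rfl)).prodMk
      (measurable_limitPosition n hη measurable_const)
  -- Here `j ≥ n + 1`, so `η j` is one of the erasers generating the tail at `n`.
  · obtain ⟨i, rfl⟩ : ∃ i, j = i + 1 := ⟨j - 1, by omega⟩
    have hηj := hη i (by omega)
    exact (measurable_eval_fin (hW (i + 1) (by omega)) hηj).prodMk
      (measurable_limitPosition (i + 1) (fun k hk => hη k (by omega))
        ((measurable_from_top (f := fun a : Fin (i + 2) => (a : ℕ))).comp hηj))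

variable [MeasurableSpace Ω] {μ : Measure Ω}
  {W : ∀ n : ℕ, Ω → (Fin (n + 1) → A)} {η : ∀ n : ℕ, Ω → Fin (n + 1)}

lemma IsGEWP.measurable_seq (h : IsGEWP μ W η) :
    Measurable (fun ω => ofPath (fun k => (W k ω, η k ω))) :=
  measurable_ofPath.comp (measurable_path h.measurable_word h.measurable_eraser)

/-- Conditions on the placement, which is uniform and independent of the tail. A permutation of the
first `n + 1` terms then merely reindexes the sum over `s`. -/
lemma IsGEWP.measure_seq_mem (h : IsGEWP μ W η) (n : ℕ) {B : Set (ℕ → A × ℝ)}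
    (hB : MeasurableSet B) :
    μ ((fun ω => ofPath (fun k => (W k ω, η k ω))) ⁻¹' B)
      = ∑ s : Equiv.Perm (Fin (n + 1)), ((n + 1)! : ℝ≥0∞)⁻¹ * μ (placedSeq W η n s ⁻¹' B) := by
  let f : Ω → Equiv.Perm (Fin (n + 1)) := fun ω => Equiv.ofBijective (place (fun k => η k ω) n)
    (Finite.injective_iff_bijective.1 (place_injective _ n))
  have hf : ∀ s, f ⁻¹' {s} = {ω | place (fun k => η k ω) n = s} := by
    intro s
    ext ω
    simp only [Set.mem_preimage, Set.mem_singleton_iff, Set.mem_ofPred_eq, f]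
    constructor
    · rintro rfl
      rfl
    · intro hs
      exact Equiv.ext fun j => congrFun hs j
  have hfm : ∀ s, MeasurableSet (f ⁻¹' {s}) := by
    intro s
    rw [hf]
    exact measurableSet_eq_fun (measurable_pi_lambda _ fun j => measurable_place
      h.measurable_eraser n j) measurable_const
  have hsum := sum_measure_preimage_singleton
    (μ := μ.restrict ((fun ω => ofPath (fun k => (W k ω, η k ω))) ⁻¹' B)) Finset.univ
    fun s _ => hfm s
  rw [Finset.coe_univ, Set.preimage_univ, Measure.restrict_apply_univ] at hsum
  rw [← hsum]
  refine Finset.sum_congr rfl fun s _ => ?_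
  rw [← h.measure_place_inter n s.injective (measurable_placedSeq W η n s hB),
    Measure.restrict_apply (hfm s), hf]
  refine measure_congr ?_
  filter_upwards [ae_all_iff.2 h.erase_ae] with ω hω
  refine propext (and_congr_right fun hs => ?_)
  change ofPath _ ∈ B ↔ placedSeq W η n s ω ∈ B
  rw [ofPath_eq_placedSeq hω n, show place (fun k => η k ω) n = s from hs]

/-- The marked sequence of a general erased-word process is exchangeable. -/
theorem IsGEWP.exchangeable (h : IsGEWP μ W η) :
    Exchangeable (μ.map fun ω => ofPath (fun k => (W k ω, η k ω))) := by
  rintro π ⟨n, hn⟩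
  have hlt : ∀ k < n + 1, π k < n + 1 := by
    intro k hk
    by_contra hlt
    have := π.injective (hn (π k) (by omega))
    omega
  let π' : Equiv.Perm (Fin (n + 1)) := Equiv.ofBijective (fun i => ⟨π i, hlt i i.2⟩)
    (Finite.injective_iff_bijective.1 fun i j hij =>
      Fin.ext (π.injective (congrArg Fin.val hij)))
  have hπ : ∀ (s : Equiv.Perm (Fin (n + 1))) (ω : Ω),
      placedSeq W η n s ω ∘ π = placedSeq W η n (s * π' : Equiv.Perm (Fin (n + 1))) ω := by
    intro s ω
    funext j
    by_cases hj : j < n + 1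
    · simp only [Function.comp_apply, placedSeq, dif_pos hj, dif_pos (hlt j hj)]
      rfl
    · simp only [Function.comp_apply, hn j (by omega), placedSeq, dif_neg hj]
  rw [Measure.map_map (measurable_comp_perm _) h.measurable_seq]
  ext B hB
  rw [Measure.map_apply ((measurable_comp_perm _).comp h.measurable_seq) hB,
    Measure.map_apply h.measurable_seq hB, h.measure_seq_mem n hB, Set.preimage_comp,
    h.measure_seq_mem n (measurable_comp_perm _ hB),
    ← Equiv.sum_comp (Equiv.mulRight π') fun s : Equiv.Perm (Fin (n + 1)) =>
      ((n + 1)! : ℝ≥0∞)⁻¹ * μ (placedSeq W η n s ⁻¹' B)]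
  refine Finset.sum_congr rfl fun s _ => ?_
  congr 2
  ext ω
  change placedSeq W η n s ω ∘ π ∈ B ↔ placedSeq W η n (s * π' : Equiv.Perm (Fin (n + 1))) ω ∈ B
  rw [hπ]

end MarkedSequence

/-! ### The marks are i.i.d. uniform and determine the erasers. -/

section Marks

/-- The marks reconstructed from the erasers. -/
noncomputable def marks (e : ∀ n : ℕ, Fin (n + 1)) : ℕ → ℝ := fun j => limitPosition e j (e j)

lemma measurable_marks : Measurable marks :=
  measurable_pi_lambda _ fun j => measurable_limitPosition
    (η := fun k (e : ∀ n : ℕ, Fin (n + 1)) => e k) j (fun _ _ => measurable_pi_apply _)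
    ((measurable_from_top (f := fun a : Fin (j + 1) => (a : ℕ))).comp (measurable_pi_apply j))

lemma measurable_lastRanks :
    Measurable (fun (x : ℕ → ℝ) (n : ℕ) => lastRank n x) :=
  measurable_pi_lambda _ measurable_lastRank

/-- The ranks of an independent uniform sequence are independent and uniform. -/
lemma map_lastRanks :
    (Measure.infinitePi fun _ : ℕ => unif).map (fun x n => lastRank n x)
      = Measure.infinitePi eraserLaw := by
  -- Only ranks matter here, so the one-letter alphabet `Unit` lets the general results on GEWPs
  -- apply.
  let ν : Measure (Unit × ℝ) := unif.map (Prod.mk ())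
  have hpm : Measurable (Prod.mk () : ℝ → Unit × ℝ) := measurable_prodMk_left
  have : IsProbabilityMeasure ν := Measure.isProbabilityMeasure_map hpm.aemeasurable
  have hν : (Measure.infinitePi fun _ : ℕ => unif).map (fun x n => ((), x n))
      = Measure.infinitePi fun _ : ℕ => ν :=
    Measure.infinitePi_map_pi (μ := fun _ : ℕ => unif) (f := fun _ => Prod.mk ()) fun _ => hpm
  have hZ : Measurable fun (x : ℕ → ℝ) (n : ℕ) => ((), x n) := by fun_prop
  have hinj : ∀ᵐ x ∂(Measure.infinitePi fun _ : ℕ => ν),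
      Function.Injective fun j => (x j).2 := by
    have hlaw : (Measure.infinitePi fun _ : ℕ => ν).map (fun x j => (x j).2)
        = Measure.infinitePi fun _ : ℕ => unif := by
      rw [← hν, Measure.map_map (by fun_prop) hZ]
      exact Measure.map_id
    refine ae_of_ae_map (f := fun (x : ℕ → Unit × ℝ) (j : ℕ) => (x j).2)
      (p := fun x => Function.Injective x)
      (by fun_prop : Measurable fun (x : ℕ → Unit × ℝ) (j : ℕ) => (x j).2).aemeasurable ?_
    rw [hlaw]
    exact ae_injective_infinitePi unif
  exact (((exchangeable_infinitePi ν).isGEWP hinj).comp hZ hν).map_erasers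

lemma map_marks : (Measure.infinitePi eraserLaw).map marks
    = Measure.infinitePi fun _ : ℕ => unif := by
  rw [← map_lastRanks, Measure.map_map measurable_marks measurable_lastRanks]
  conv_rhs => rw [← Measure.map_id (μ := Measure.infinitePi fun _ : ℕ => unif)]
  refine Measure.map_congr ?_
  filter_upwards [ae_mem_rankRegular] with x hx
  exact funext fun j => limitPosition_lastRank hx.1 j (hx.2 j)

/-- A property of the law of the erasers alone, so it is verified in the model of ranks of uniform
variables, where the marks are the variables. -/
lemma ae_lastRank_marks :
    ∀ᵐ e ∂(Measure.infinitePi eraserLaw), ∀ n, lastRank n (marks e) = e n := by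
  rw [← map_lastRanks, ae_map_iff measurable_lastRanks.aemeasurable]
  · filter_upwards [ae_mem_rankRegular] with x hx n
    congr 1
    exact funext fun j => limitPosition_lastRank hx.1 j (hx.2 j)
  · simp only [Set.ofPred_forall]
    exact MeasurableSet.iInter fun n => measurableSet_eq_fun
      ((measurable_lastRank n).comp measurable_marks) (measurable_pi_apply n)

variable {A : Type u} [MeasurableSpace A] {Ω : Type v} [MeasurableSpace Ω] {μ : Measure Ω}
  {W : ∀ n : ℕ, Ω → (Fin (n + 1) → A)} {η : ∀ n : ℕ, Ω → Fin (n + 1)}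

/-- The marks of a general erased-word process are independent and uniformly distributed. -/
theorem IsGEWP.map_marks (h : IsGEWP μ W η) :
    μ.map (fun ω j => (ofPath (fun k => (W k ω, η k ω)) j).2)
      = Measure.infinitePi fun _ : ℕ => unif := by
  rw [← ErasedWord.map_marks, ← h.map_erasers, Measure.map_map measurable_marks
    (measurable_pi_lambda _ h.measurable_eraser)]
  rfl

/-- A general erased-word process is almost surely reconstructed from its marked sequence. -/
theorem IsGEWP.toPath_ofPath (h : IsGEWP μ W η) :
    ∀ᵐ ω ∂μ, toPath (ofPath fun k => (W k ω, η k ω)) = fun k => (W k ω, η k ω) := by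
  have hm := measurable_pi_lambda _ h.measurable_eraser
  have h1 := ae_lastRank_marks
  rw [← h.map_erasers] at h1
  have h2 := ae_injective_infinitePi unif
  rw [← h.map_marks] at h2
  have hsnd : Measurable fun ω j => (ofPath (fun k => (W k ω, η k ω)) j).2 :=
    measurable_pi_lambda _ fun j => measurable_snd.comp
      ((measurable_pi_apply j).comp h.measurable_seq)
  filter_upwards [ae_of_ae_map hm.aemeasurable h1, ae_of_ae_map hsnd.aemeasurable h2,
    ae_all_iff.2 h.erase_ae] with ω hrank hinj herase
  exact ErasedWord.toPath_ofPath herase hinj hrank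

end Marks

/-! ### Extreme points and the bijection. -/

section Ergodic

variable {A : Type u} [MeasurableSpace A]

lemma measurable_sequence_snd : Measurable fun (x : ℕ → A × ℝ) (j : ℕ) => (x j).2 := by fun_prop

lemma isProbabilityMeasure_of_mem_gewpLaws {P : Measure (PathSpace A)} (hP : P ∈ gewpLaws A) :
    IsProbabilityMeasure P := by
  obtain ⟨Ω, _, μ, W, η, h, rfl⟩ := hP
  have := h.isProbabilityMeasure
  exact Measure.isProbabilityMeasure_map
    (measurable_path h.measurable_word h.measurable_eraser).aemeasurable

lemma IsGEWP.map_ofPath_law {Ω : Type v} [MeasurableSpace Ω] {μ : Measure Ω}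
    {W : ∀ n : ℕ, Ω → (Fin (n + 1) → A)} {η : ∀ n : ℕ, Ω → Fin (n + 1)} (h : IsGEWP μ W η) :
    (law μ W η).map ofPath = μ.map fun ω => ofPath fun k => (W k ω, η k ω) :=
  Measure.map_map measurable_ofPath (measurable_path h.measurable_word h.measurable_eraser)

lemma exchangeable_map_ofPath {P : Measure (PathSpace A)} (hP : P ∈ gewpLaws A) :
    Exchangeable (P.map ofPath) := by
  obtain ⟨Ω, _, μ, W, η, h, rfl⟩ := hP
  rw [h.map_ofPath_law]
  exact h.exchangeable

lemma map_snd_map_ofPath {P : Measure (PathSpace A)} (hP : P ∈ gewpLaws A) :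
    (P.map ofPath).map (fun x j => (x j).2) = Measure.infinitePi fun _ : ℕ => unif := by
  obtain ⟨Ω, _, μ, W, η, h, rfl⟩ := hP
  rw [h.map_ofPath_law, Measure.map_map measurable_sequence_snd h.measurable_seq]
  exact h.map_marks

lemma map_toPath_map_ofPath {P : Measure (PathSpace A)} (hP : P ∈ gewpLaws A) :
    (P.map ofPath).map toPath = P := by
  obtain ⟨Ω, _, μ, W, η, h, rfl⟩ := hP
  rw [h.map_ofPath_law, Measure.map_map measurable_toPath h.measurable_seq]
  exact Measure.map_congr h.toPath_ofPath

lemma ae_mem_rankRegular_of_map_snd {Q : Measure (ℕ → A × ℝ)}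
    (hQ : Q.map (fun x j => (x j).2) = Measure.infinitePi fun _ : ℕ => unif) :
    ∀ᵐ x ∂Q, (fun j => (x j).2) ∈ rankRegular := by
  have h := ae_mem_rankRegular
  rw [← hQ] at h
  exact ae_of_ae_map measurable_sequence_snd.aemeasurable h

lemma map_ofPath_map_toPath {Q : Measure (ℕ → A × ℝ)}
    (hQ : ∀ᵐ x ∂Q, (fun j => (x j).2) ∈ rankRegular) : (Q.map toPath).map ofPath = Q := by
  rw [Measure.map_map measurable_ofPath measurable_toPath]
  conv_rhs => rw [← Measure.map_id (μ := Q)]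
  refine Measure.map_congr ?_
  filter_upwards [hQ] with x hx
  exact ofPath_toPath hx

lemma Exchangeable.map_toPath_mem {Q : Measure (ℕ → A × ℝ)} [IsProbabilityMeasure Q]
    (hQ : Exchangeable Q) (hinj : ∀ᵐ x ∂Q, Function.Injective fun j => (x j).2) :
    Q.map toPath ∈ gewpLaws A :=
  ⟨ℕ → A × ℝ, inferInstance, Q, _, _, hQ.isGEWP hinj, rfl⟩

lemma map_snd_infinitePi {ρ : Measure (A × ℝ)} (hρ : ρ ∈ uniformSecondMarginal A) :
    (Measure.infinitePi fun _ : ℕ => ρ).map (fun x j => (x j).2)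
      = Measure.infinitePi fun _ : ℕ => unif := by
  have := hρ.1
  rw [Measure.infinitePi_map_pi (μ := fun _ : ℕ => ρ) (f := fun _ => Prod.snd)
    fun _ => measurable_snd]
  simp only [hρ.2]

lemma map_ofPath_lawGL {ρ : Measure (A × ℝ)} (hρ : ρ ∈ uniformSecondMarginal A) :
    (lawGL ρ).map ofPath = Measure.infinitePi fun _ : ℕ => ρ :=
  map_ofPath_map_toPath (ae_mem_rankRegular_of_map_snd (map_snd_infinitePi hρ))

lemma isGEWP_infinitePi {ρ : Measure (A × ℝ)} (hρ : ρ ∈ uniformSecondMarginal A) :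
    IsGEWP (Measure.infinitePi fun _ : ℕ => ρ) (fun n x => (toPath x n).1)
      (fun n x => (toPath x n).2) := by
  have := hρ.1
  exact (exchangeable_infinitePi ρ).isGEWP
    ((ae_mem_rankRegular_of_map_snd (map_snd_infinitePi hρ)).mono fun x hx => hx.1)

theorem lawGL_mem_ergodicLaws {ρ : Measure (A × ℝ)} (hρ : ρ ∈ uniformSecondMarginal A) :
    lawGL ρ ∈ ergodicLaws A := by
  have := hρ.1
  refine mem_extremePoints_iff_left.2 ⟨⟨ℕ → A × ℝ, inferInstance, _, _, _, isGEWP_infinitePi hρ,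
    rfl⟩, ?_⟩
  rintro P₁ h₁ P₂ h₂ ⟨a, b, ha, hb, hab, hP⟩
  -- A component of a convex decomposition is absolutely continuous to the mixture. Transported by
  -- `ofPath` it is exchangeable, and ergodicity of the product measure leaves no choice.
  have hac : P₁ ≪ lawGL ρ := by
    rw [← hP]
    refine (Measure.AbsolutelyContinuous.add_right ?_ _)
    exact Measure.absolutelyContinuous_smul (ENNReal.coe_ne_zero.2 ha.ne')
  have hQ := hac.map measurable_ofPath
  rw [map_ofPath_lawGL hρ] at hQ
  have := isProbabilityMeasure_of_mem_gewpLaws h₁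
  have : IsProbabilityMeasure (P₁.map ofPath) :=
    Measure.isProbabilityMeasure_map measurable_ofPath.aemeasurable
  rw [← map_toPath_map_ofPath h₁,
    (exchangeable_map_ofPath h₁).eq_infinitePi_of_absolutelyContinuous hQ]
  rfl

/-- The product measure is recovered from the law by `ofPath`, and `ρ` is its one-dimensional
marginal. -/
lemma lawGL_injOn : Set.InjOn (lawGL (A := A)) (uniformSecondMarginal A) := by
  intro ρ hρ ρ' hρ' heq
  have := hρ.1
  have := hρ'.1
  have h := congrArg (fun P => (P.map ofPath).map fun x => x 0) heq
  simp only [map_ofPath_lawGL hρ, map_ofPath_lawGL hρ'] at h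
  rwa [Measure.infinitePi_map_eval, Measure.infinitePi_map_eval] at h

/-- Conditioning on the first coordinate and shifting preserves exchangeability. -/
lemma Exchangeable.map_shift_restrict {E : Type*} [MeasurableSpace E] {Q : Measure (ℕ → E)}
    (hQ : Exchangeable Q) {B : Set E} (hB : MeasurableSet B) :
    Exchangeable ((Q.restrict {x | x 0 ∈ B}).map shift) := by
  rintro π ⟨n, hn⟩
  -- The permutation `π` moved one place up, fixing `0`: it preserves the conditioning event and
  -- commutes with the shift as required.
  let π' : Equiv.Perm ℕ := ⟨fun k => k.casesOn 0 fun k => π k + 1,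
    fun k => k.casesOn 0 fun k => π.symm k + 1, fun k => by cases k <;> simp,
    fun k => by cases k <;> simp⟩
  have hm : Measurable fun x : ℕ → E => x ∘ π' := measurable_comp_perm _
  have hB' : MeasurableSet {x : ℕ → E | x 0 ∈ B} := measurable_pi_apply 0 hB
  have hinv : (Q.restrict {x | x 0 ∈ B}).map (fun x => x ∘ π') = Q.restrict {x | x 0 ∈ B} := by
    have hQ' := hQ π' ⟨n + 1, fun k hk => ?_⟩
    · conv_rhs => rw [← hQ']
      rw [Measure.restrict_map hm hB']
      rfl
    · obtain ⟨i, rfl⟩ : ∃ i, k = i + 1 := ⟨k - 1, by omega⟩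
      exact congrArg Nat.succ (hn i (by omega))
  rw [Measure.map_map (measurable_comp_perm _) measurable_shift]
  conv_rhs => rw [← hinv, Measure.map_map measurable_shift hm]
  rfl

lemma Exchangeable.smul {E : Type*} [MeasurableSpace E] {Q : Measure (ℕ → E)}
    (hQ : Exchangeable Q) (c : ℝ≥0) : Exchangeable (c • Q) := by
  intro π hπ
  rw [Measure.map_smul, hQ π hπ]

/-- If the law built from an exchangeable sequence with uniform marks is ergodic, then the first
member of the sequence is independent of the others. -/
lemma Exchangeable.factorizes {Q : Measure (ℕ → A × ℝ)} [IsProbabilityMeasure Q]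
    (hQ : Exchangeable Q) (hreg : ∀ᵐ x ∂Q, (fun j => (x j).2) ∈ rankRegular)
    (herg : Q.map toPath ∈ ergodicLaws A) {B : Set (A × ℝ)} (hB : MeasurableSet B) :
    (Q.restrict {x | x 0 ∈ B}).map shift = Q {x | x 0 ∈ B} • Q := by
  have hms : ∀ {B : Set (A × ℝ)}, MeasurableSet B →
      MeasurableSet {x : ℕ → A × ℝ | x 0 ∈ B} := fun hB => measurable_pi_apply 0 hB
  have hcompl : {x : ℕ → A × ℝ | x 0 ∈ Bᶜ} = {x : ℕ → A × ℝ | x 0 ∈ B}ᶜ := rfl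
  let R : Set (A × ℝ) → Measure (ℕ → A × ℝ) := fun B => (Q.restrict {x | x 0 ∈ B}).map shift
  -- Shift invariance of `Q` is what makes the two shifted pieces add up to `Q` itself.
  have hadd : R B + R Bᶜ = Q := by
    simp only [R]
    rw [← Measure.map_add _ _ measurable_shift, hcompl, Measure.restrict_add_restrict_compl (hms hB),
      hQ.map_shift]
  have hle : ∀ B, R B ≪ Q := fun B => by
    have := (Measure.absolutelyContinuous_of_le (Measure.restrict_le_self (μ := Q)
      (s := {x | x 0 ∈ B}))).map measurable_shift
    rwa [hQ.map_shift] at this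
  have huniv : ∀ B, R B Set.univ = Q {x | x 0 ∈ B} := fun B => by
    rw [Measure.map_apply measurable_shift MeasurableSet.univ, Set.preimage_univ,
      Measure.restrict_apply_univ]
  let c : Set (A × ℝ) → ℝ≥0 := fun B => (Q {x | x 0 ∈ B}).toNNReal
  have hc : ∀ B, (c B : ℝ≥0∞) = Q {x | x 0 ∈ B} := fun B =>
    ENNReal.coe_toNNReal (measure_ne_top _ _)
  have hsum : c B + c Bᶜ = 1 := by
    have : Q {x | x 0 ∈ B} + Q {x | x 0 ∈ Bᶜ} = 1 := by
      rw [hcompl, prob_add_prob_compl (hms hB)]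
    rw [← hc, ← hc] at this
    exact_mod_cast this
  have hzero : ∀ B, c B = 0 → R B = 0 := fun B h0 => by
    rw [← Measure.measure_univ_eq_zero, huniv, ← hc, h0, ENNReal.coe_zero]
  change R B = _
  rw [← hc]
  rcases eq_or_ne (c B) 0 with h0 | h0
  · rw [hzero B h0, h0]
    simp
  rcases eq_or_ne (c Bᶜ) 0 with h1 | h1
  · rw [h1, add_zero] at hsum
    rw [hzero _ h1, add_zero] at hadd
    rw [hadd, hsum]
    simp
  have hmem : ∀ B, MeasurableSet B → c B ≠ 0 → ((c B)⁻¹ • R B).map toPath ∈ gewpLaws A := by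
    intro B hB hne
    have : IsProbabilityMeasure ((c B)⁻¹ • R B) := ⟨by
      rw [Measure.smul_apply, huniv, ← hc, ENNReal.smul_def, smul_eq_mul, ← ENNReal.coe_mul,
        inv_mul_cancel₀ hne, ENNReal.coe_one]⟩
    refine ((hQ.map_shift_restrict hB).smul _).map_toPath_mem ?_
    exact ((Measure.AbsolutelyContinuous.smul_left (hle B) _).ae_le
      (hreg.mono fun x hx => hx.1))
  -- The weights are the probabilities of the two events, both nonzero here. Normalising the pieces
  -- gives GEWP laws with mixture `Q.map toPath`.
  have hext := (mem_extremePoints_iff_left.1 herg).2 _ (hmem B hB h0) _ (hmem _ hB.compl h1)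
    ⟨c B, c Bᶜ, pos_iff_ne_zero.2 h0, pos_iff_ne_zero.2 h1, hsum, by
      rw [Measure.map_smul, Measure.map_smul, smul_smul, smul_smul, mul_inv_cancel₀ h0,
        mul_inv_cancel₀ h1, one_smul, one_smul, ← Measure.map_add _ _ measurable_toPath, hadd]⟩
  -- Applying `ofPath` undoes `toPath`, since both `Q` and the piece `R B ≪ Q` live on sequences
  -- with regular marks.
  have hext' := congrArg (fun P => c B • P.map ofPath) hext
  simp only [Measure.map_smul] at hext'
  rw [map_ofPath_map_toPath hreg, map_ofPath_map_toPath ((hle B).ae_le hreg), smul_smul,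
    mul_inv_cancel₀ h0, one_smul] at hext'
  exact hext'

theorem exists_eq_lawGL {P : Measure (PathSpace A)} (hP : P ∈ ergodicLaws A) :
    ∃ ρ ∈ uniformSecondMarginal A, lawGL ρ = P := by
  have hG : P ∈ gewpLaws A := hP.1
  have := isProbabilityMeasure_of_mem_gewpLaws hG
  set Q := P.map ofPath with hQdef
  have : IsProbabilityMeasure Q := Measure.isProbabilityMeasure_map measurable_ofPath.aemeasurable
  have hreg := ae_mem_rankRegular_of_map_snd (map_snd_map_ofPath hG)
  have herg : Q.map toPath ∈ ergodicLaws A := by rwa [hQdef, map_toPath_map_ofPath hG]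
  have hprod := Exchangeable.eq_infinitePi_of_factorizes (Q := Q) fun B C hB hC => by
    have h := congrArg (fun ν => ν C)
      ((exchangeable_map_ofPath hG).factorizes hreg herg hB)
    simp only [Measure.smul_apply, smul_eq_mul] at h
    rw [Measure.map_apply measurable_shift hC,
      Measure.restrict_apply (measurable_shift hC), Set.inter_comm] at h
    exact h
  have hm0 : Measurable fun x : ℕ → A × ℝ => x 0 := measurable_pi_apply 0
  refine ⟨Q.map fun x => x 0, ⟨Measure.isProbabilityMeasure_map hm0.aemeasurable, ?_⟩, ?_⟩
  · have h := congrArg (fun ν => ν.map fun x : ℕ → ℝ => x 0) (map_snd_map_ofPath hG)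
    rw [Measure.infinitePi_map_eval, Measure.map_map (measurable_pi_apply 0)
      measurable_sequence_snd] at h
    rw [Measure.map_map measurable_snd hm0]
    exact h
  · change (Measure.infinitePi fun _ : ℕ => Q.map fun x => x 0).map toPath = P
    rw [← hprod, hQdef, map_toPath_map_ofPath hG]

theorem bijOn_lawGL : Set.BijOn (lawGL (A := A)) (uniformSecondMarginal A) (ergodicLaws A) :=
  ⟨fun _ hρ => lawGL_mem_ergodicLaws hρ, lawGL_injOn, fun _ hP => exists_eq_lawGL hP⟩

end Ergodic

end ErasedWord

theorem theorem1 (A : Type u) [MeasurableSpace A] [StandardBorelSpace A] :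
    (∀ (ρ : Measure (A × ℝ)), ρ ∈ ErasedWord.uniformSecondMarginal A →
      ∀ (Ω : Type v) [MeasurableSpace Ω] (μ : Measure Ω) [IsProbabilityMeasure μ]
        (Y : ℕ → Ω → A) (U : ℕ → Ω → ℝ),
        (∀ j, Measurable (Y j)) → (∀ j, Measurable (U j)) →
        iIndepFun (fun (j : ℕ) (ω : Ω) => (Y j ω, U j ω)) μ →
        (∀ j, μ.map (fun ω => (Y j ω, U j ω)) = ρ) →
        ErasedWord.IsErgodicGEWP μ
            (fun n ω => ErasedWord.word n (fun j => Y j ω) (fun j => U j ω))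
            (fun n ω => ErasedWord.lastRank n (fun j => U j ω)) ∧
          ErasedWord.law μ
              (fun n ω => ErasedWord.word n (fun j => Y j ω) (fun j => U j ω))
              (fun n ω => ErasedWord.lastRank n (fun j => U j ω)) =
            ErasedWord.lawGL ρ) ∧
      Set.BijOn (ErasedWord.lawGL (A := A)) (ErasedWord.uniformSecondMarginal A)
        (ErasedWord.ergodicLaws A) := by
  refine ⟨fun ρ hρ Ω _ μ _ Y U hY hU hind hlaw => ?_, ErasedWord.bijOn_lawGL⟩
  have hZ : Measurable fun ω j => (Y j ω, U j ω) :=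
    measurable_pi_lambda _ fun j => (hY j).prodMk (hU j)
  -- An i.i.d. sequence on any space has the product law, so everything transfers from the
  -- coordinate model.
  have hmap : μ.map (fun ω j => (Y j ω, U j ω)) = Measure.infinitePi fun _ : ℕ => ρ := by
    rw [(iIndepFun_iff_map_fun_eq_infinitePi_map fun j => (hY j).prodMk (hU j)).1 hind]
    simp only [hlaw]
  have hGL : ErasedWord.law μ
      (fun n ω => ErasedWord.word n (fun j => Y j ω) (fun j => U j ω))
      (fun n ω => ErasedWord.lastRank n (fun j => U j ω)) = ErasedWord.lawGL ρ := by
    change _ = (Measure.infinitePi fun _ : ℕ => ρ).map ErasedWord.toPath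
    rw [← hmap, Measure.map_map ErasedWord.measurable_toPath hZ]
    rfl
  refine ⟨⟨(ErasedWord.isGEWP_infinitePi hρ).comp hZ hmap, ?_⟩, hGL⟩
  rw [hGL]
  exact ErasedWord.lawGL_mem_ergodicLaws hρ
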